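/- Let $\alpha\in(0,1]$, $\tau>0$ and let $m$ be a natural number. For a function $x$ that is continuous on $[0,\infty)$, let $${}^{C}D^{\alpha}_{0^+}x(t)=\frac{d}{dt}\,I^{1-\alpha}_{0^+}\bigl(x-x(0)\bigr)(t),\qquad I^{\beta}_{0^+}x(t)=\frac1{\Gamma(\beta)}\int_0^t(t-u)^{\beta-1}x(u)\,du\ \ (\beta>0),\qquad I^0_{0^+}x=x,$$ be the Caputo fractional derivative of order $\alpha$, and let $E_\alpha(x)=\sum_{k=0}^\infty \frac{x^k}{\Gamma(\alpha k+1)}$ be the Mittag-Leffler function. Let $w:[-\tau,\infty)\to[0,\infty)$ be continuous and such that ${}^{C}D^{\alpha}_{0^+}w(t)$ exists for every $t>0$. Let $a$, $b_1,\dots,b_m$, $c$ be nonnegative continuous functions on $[0,\infty)$, let $q_1,\dots,q_m:[0,\infty)\to[0,\tau]$ be continuous, and let $\varphi:[-\tau,0]\to[0,\infty)$ be continuous. Suppose that $${}^{C}D^{\alpha}_{0^+}w(t)\le -a(t)w(t)+\sum_{k=1}^m b_k(t)\sup_{t-q_k(t)\le s\le t}w(s)+c(t)\quad(t>0),\qquad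 w(s)=\varphi(s)\quad(s\in[-\tau,0]),$$ that $c^*:=\sup_{t\ge0}c(t)<\infty$, and that one of the following two conditions holds: - (C1) $a$ is bounded on $[0,\infty)$, and there is a constant $\sigma>0$ with $a(t)-\sum_{k=1}^m b_k(t)\ge\sigma$ for all $t\ge0$; in this case put $w_0=c^*/\sigma$. - (C2) There are constants $a_0>0$ and $p<1$ with $a(t)\ge a_0$ for all $t\ge0$ and $\sup_{t\ge0}\sum_{k=1}^m \frac{b_k(t)}{a(t)}\le p$; in this case put $w_0=\frac{c^*}{(1-p)a_0}$. Then for every $t\ge0$ the equation $$\lambda-a(t)+\sum_{k=1}^m\frac{b_k(t)}{E_\alpha(-\lambda\, q_k(t)^\alpha)}=0$$ has exactly one real root $\lambda=\lambda(t)$. Moreover, $w_0\ge0$, the number $\lambda^*:=\inf_{t\ge0}\lambda(t)$ is positive, and $$w(t)\le w_0+\Bigl(\sup_{s\in[-\tau,0]}|\varphi(s)|\Bigr)E_\alpha(-\lambda^*t^\alpha)\qquad\text{for all }t\ge0.$$ -/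

import Mathlib

noncomputable section

namespace FracHalanay

/-- The classical Mittag-Leffler function `E_α(x) = ∑ xᵏ / Γ(α k + 1)` of a real variable. -/
def mittagLeffler (α x : ℝ) : ℝ :=
  ∑' k : ℕ, x ^ k / Real.Gamma (α * k + 1)

/-- The Riemann--Liouville fractional integral of order `β ≥ 0` based at `0`, with the usual
convention that the integral of order `0` is the identity. -/
def rlIntegral (β : ℝ) (x : ℝ → ℝ) (t : ℝ) : ℝ :=
  if β = 0 then x t
  else 1 / Real.Gamma β * ∫ u in (0 : ℝ)..t, (t - u) ^ (β - 1) * x u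

/-- The Caputo derivative of order `α ∈ (0, 1]` of `x` exists at `t > 0`. -/
def CaputoDifferentiableAt (α : ℝ) (x : ℝ → ℝ) (t : ℝ) : Prop :=
  DifferentiableAt ℝ (rlIntegral (1 - α) (fun u => x u - x 0)) t

/-- The Caputo derivative of order `α ∈ (0, 1]`:
the ordinary derivative of `I^{1-α} (x - x(0))`. -/
def caputoDeriv (α : ℝ) (x : ℝ → ℝ) (t : ℝ) : ℝ :=
  deriv (rlIntegral (1 - α) (fun u => x u - x 0)) t

/-- The characteristic function `λ ↦ λ - a(t) + ∑ₖ bₖ(t) / E_α(-λ qₖ(t)^α)` at time `t`. -/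
def charFun {m : ℕ} (α : ℝ) (a : ℝ → ℝ) (b q : Fin m → ℝ → ℝ) (t l : ℝ) : ℝ :=
  l - a t + ∑ k, b k t / mittagLeffler α (-l * q k t ^ α)

/-- The infimum, over all `t ≥ 0`, of the roots of the characteristic function at time `t`. -/
def lambdaStar {m : ℕ} (α : ℝ) (a : ℝ → ℝ) (b q : Fin m → ℝ → ℝ) : ℝ :=
  sInf {l : ℝ | ∃ t : ℝ, 0 ≤ t ∧ charFun α a b q t l = 0}

end FracHalanay

end

/-! The bound is a first-touching argument. Put `e t = E_α(-λ* t^α)` and suppose `w` exceeds the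
barrier `w₀ + M e`, where `M` is the supremum of `|φ|`. Raise the barrier by a small `ε` and let `T`
be the first contact time. The gap `g` is nonnegative on `[0, T]` and vanishes at `T`, yet the
differential inequality at `T` makes `I^{1-α} g` increase linearly up to `T`. The extremum principle
`not_linear_growth_rlIntegral` excludes this.

Only continuity of `w` and existence of its Caputo derivative are available, so that principle
cannot use a formula for the derivative at an extremum. After reflecting time, Abel's inversion
recovers the integral of `g` near `T` from its fractional integral; linear growth would force that
integral over a window of length `x` to be of order `x`, contradicting `g T = 0`.

The same principle gives the comparison lemma `nonneg_of_supersolution`, from which `e` is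
nonnegative, nonincreasing in time and rate, and supermultiplicative, hence positive.
Supermultiplicativity yields `e s ≤ e T / e r` for `T - r ≤ s ≤ T`, which is why `1 / E_α(-λ qₖ^α)`
appears in the characteristic equation.

The characteristic function is strictly increasing in `λ`, so it is nonpositive at `λ*`, which is
all the barrier needs. A uniform gap between `a` and `∑ bₖ`, and a uniform ratio, come from either
(C1) or (C2). -/

namespace FracHalanay

open Set MeasureTheory Filter Topology intervalIntegral

/-! ### Gamma estimates and the Mittag-Leffler series. -/

/-- Euler's beta integral on `[0, x]`. -/
theorem integral_rpow_mul_rpow_sub {s t x : ℝ} (hs : 0 < s) (ht : 0 < t) (hx : 0 < x) :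
    ∫ u in (0 : ℝ)..x, u ^ (s - 1) * (x - u) ^ (t - 1) =
      x ^ (s + t - 1) * (Real.Gamma s * Real.Gamma t / Real.Gamma (s + t)) := by
  have h := Complex.betaIntegral_scaled (s : ℂ) (t : ℂ) hx
  rw [Complex.betaIntegral_eq_Gamma_mul_div _ _ (by simpa) (by simpa)] at h
  have h2 : ∫ u in (0 : ℝ)..x, ((u : ℂ) ^ ((s : ℂ) - 1) * ((x : ℂ) - u) ^ ((t : ℂ) - 1)) =
      ((∫ u in (0 : ℝ)..x, u ^ (s - 1) * (x - u) ^ (t - 1) : ℝ) : ℂ) := by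
    rw [← intervalIntegral.integral_ofReal]
    apply intervalIntegral.integral_congr
    intro u hu
    rw [uIcc_of_le hx.le] at hu
    simp only [Complex.ofReal_mul]
    rw [Complex.ofReal_cpow hu.1, Complex.ofReal_cpow (by linarith [hu.2])]
    push_cast
    rfl
  rw [h2] at h
  have h3 : ((x : ℂ) ^ ((s : ℂ) + t - 1)) = ((x ^ (s + t - 1) : ℝ) : ℂ) := by
    rw [Complex.ofReal_cpow hx.le]
    push_cast
    rfl
  rw [h3, ← Complex.ofReal_add, Complex.Gamma_ofReal, Complex.Gamma_ofReal,
    Complex.Gamma_ofReal] at h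
  exact_mod_cast h

/-- Keep only the tail `u > R` of the Gamma integral, where `u ^ y ≥ R ^ y`. Since `R` is free,
Gamma outgrows every geometric sequence. -/
theorem rpow_mul_exp_neg_le_Gamma {R y : ℝ} (hR : 0 < R) (hy : 0 ≤ y) :
    R ^ y * Real.exp (-R) ≤ Real.Gamma (y + 1) := by
  rw [Real.Gamma_eq_integral (by linarith)]
  have hint := Real.GammaIntegral_convergent (s := y + 1) (by linarith)
  have h1 : ∫ u in Ioi R, R ^ y * Real.exp (-u) = R ^ y * Real.exp (-R) := by
    rw [MeasureTheory.integral_const_mul, integral_exp_neg_Ioi]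
  rw [← h1]
  calc ∫ u in Ioi R, R ^ y * Real.exp (-u)
      ≤ ∫ u in Ioi R, Real.exp (-u) * u ^ (y + 1 - 1) := by
        apply setIntegral_mono_on
        · exact (integrableOn_exp_neg_Ioi R).const_mul _
        · exact hint.mono_set (Ioi_subset_Ioi hR.le)
        · exact measurableSet_Ioi
        · intro u hu
          rw [mul_comm, add_sub_cancel_right]
          have : R ^ y ≤ u ^ y := Real.rpow_le_rpow hR.le (le_of_lt hu) hy
          gcongr
    _ ≤ ∫ u in Ioi 0, Real.exp (-u) * u ^ (y + 1 - 1) := by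
        apply setIntegral_mono_set hint
        · filter_upwards [ae_restrict_mem measurableSet_Ioi] with u hu
          have : (0 : ℝ) < u := hu
          simp only [Pi.zero_apply]
          positivity
        · exact (Ioi_subset_Ioi hR.le).eventuallyLE

theorem Gamma_mul_add_one_pos {α : ℝ} (hα : 0 < α) (k : ℕ) : 0 < Real.Gamma (α * k + 1) :=
  Real.Gamma_pos_of_pos (by positivity)

theorem summable_mittagLeffler {α : ℝ} (hα : 0 < α) (x : ℝ) :
    Summable fun k : ℕ => x ^ k / Real.Gamma (α * k + 1) := by
  -- With `R ^ α = 2|x| + 1` the terms are dominated by a geometric series of ratio `1/2`.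
  set R : ℝ := (2 * |x| + 1) ^ (1 / α) with hRdef
  have hR : 0 < R := by positivity
  have hRα : R ^ α = 2 * |x| + 1 := by
    rw [hRdef, ← Real.rpow_mul (by positivity), one_div_mul_cancel hα.ne', Real.rpow_one]
  have hgeo : Summable fun k : ℕ => Real.exp R * (1 / 2 : ℝ) ^ k :=
    (summable_geometric_of_lt_one (by norm_num) (by norm_num)).mul_left _
  refine Summable.of_norm_bounded hgeo fun k => ?_
  rw [Real.norm_eq_abs, abs_div, abs_pow, abs_of_pos (Gamma_mul_add_one_pos hα k),
    div_le_iff₀ (Gamma_mul_add_one_pos hα k)]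
  have h1 := rpow_mul_exp_neg_le_Gamma hR (y := α * k) (by positivity)
  rw [Real.rpow_mul hR.le, hRα, Real.rpow_natCast] at h1
  calc |x| ^ k ≤ ((1 / 2) * (2 * |x| + 1)) ^ k := by
        gcongr
        linarith
    _ = Real.exp R * (1 / 2 : ℝ) ^ k * ((2 * |x| + 1) ^ k * Real.exp (-R)) := by
        rw [mul_pow, Real.exp_neg]
        field_simp
    _ ≤ _ := by gcongr

theorem continuous_mittagLeffler {α : ℝ} (hα : 0 < α) : Continuous (mittagLeffler α) := by
  rw [continuous_iff_continuousAt]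
  intro x
  have h : ContinuousOn (mittagLeffler α) (Icc (-(|x| + 1)) (|x| + 1)) := by
    refine continuousOn_tsum (fun k => by fun_prop) (summable_mittagLeffler hα (|x| + 1))
      fun k y hy => ?_
    rw [Real.norm_eq_abs, abs_div, abs_pow, abs_of_pos (Gamma_mul_add_one_pos hα k)]
    have : |y| ≤ |x| + 1 := abs_le.2 hy
    have := (Gamma_mul_add_one_pos hα k).le
    gcongr
  refine h.continuousAt (Icc_mem_nhds ?_ ?_)
  · linarith [neg_abs_le x]
  · linarith [le_abs_self x]

@[simp] theorem mittagLeffler_zero (α : ℝ) : mittagLeffler α 0 = 1 := by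
  rw [mittagLeffler, tsum_eq_single 0]
  · simp
  · intro k hk
    simp [hk]

theorem mittagLeffler_monotoneOn {α : ℝ} (hα : 0 < α) : MonotoneOn (mittagLeffler α) (Ici 0) := by
  intro x hx y _ hxy
  refine (summable_mittagLeffler hα x).tsum_le_tsum (fun k => ?_) (summable_mittagLeffler hα y)
  have := (Gamma_mul_add_one_pos hα k).le
  have : (0 : ℝ) ≤ x := hx
  gcongr

theorem one_le_mittagLeffler {α x : ℝ} (hα : 0 < α) (hx : 0 ≤ x) : 1 ≤ mittagLeffler α x := by
  have := mittagLeffler_monotoneOn hα (mem_Ici.2 le_rfl) hx hx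
  rwa [mittagLeffler_zero] at this

theorem continuous_mittagLeffler_mul_rpow {α : ℝ} (hα : 0 < α) (l : ℝ) :
    Continuous fun t : ℝ => mittagLeffler α (-l * t ^ α) :=
  (continuous_mittagLeffler hα).comp
    (continuous_const.mul (Real.continuous_rpow_const hα.le))

/-! ### Termwise fractional integration of the Mittag-Leffler function. -/

theorem intervalIntegrable_rpow_sub {r t c d : ℝ} (hr : -1 < r) :
    IntervalIntegrable (fun u : ℝ => (t - u) ^ r) volume c d := by
  have h := (intervalIntegrable_rpow' (a := t - c) (b := t - d) hr).comp_sub_left t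
  simpa using h

theorem intervalIntegrable_rpow_sub_mul {r t c d : ℝ} {f : ℝ → ℝ} (hr : -1 < r)
    (hf : ContinuousOn f (uIcc c d)) :
    IntervalIntegrable (fun u : ℝ => (t - u) ^ r * f u) volume c d :=
  (intervalIntegrable_rpow_sub hr).mul_continuousOn hf

theorem hasSum_mittagLeffler {α : ℝ} (hα : 0 < α) (x : ℝ) :
    HasSum (fun k : ℕ => x ^ k / Real.Gamma (α * k + 1)) (mittagLeffler α x) :=
  (summable_mittagLeffler hα x).hasSum

theorem hasSum_mittagLeffler_sub_one {α : ℝ} (hα : 0 < α) (x : ℝ) :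
    HasSum (fun k : ℕ => x ^ (k + 1) / Real.Gamma (α * (k + 1 : ℕ) + 1))
      (mittagLeffler α x - 1) := by
  have h := (hasSum_nat_add_iff' 1).2 (hasSum_mittagLeffler hα x)
  simpa using h

/-- A series dominated on `[0, t]` by the Mittag-Leffler series may be integrated termwise against
an integrable nonnegative kernel. -/
theorem hasSum_integral_kernel_mul {t : ℝ} (ht : 0 ≤ t) {κ : ℝ → ℝ}
    (hκ : IntervalIntegrable κ volume 0 t) {F : ℕ → ℝ → ℝ} (hF : ∀ k, Continuous (F k))
    {f : ℝ → ℝ} {M : ℕ → ℝ} (hM : Summable M) (hFM : ∀ k, ∀ u ∈ Icc 0 t, |F k u| ≤ M k)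
    (hf : ∀ u ∈ Icc 0 t, HasSum (fun k => F k u) (f u)) :
    HasSum (fun k => ∫ u in (0 : ℝ)..t, κ u * F k u) (∫ u in (0 : ℝ)..t, κ u * f u) := by
  have hsub : uIoc (0 : ℝ) t ⊆ Icc 0 t := by
    rw [uIoc_of_le ht]
    exact Ioc_subset_Icc_self
  refine intervalIntegral.hasSum_integral_of_dominated_convergence (fun k u => |κ u| * M k)
    (fun k => ?_) (fun k => ?_) ?_ ?_ ?_
  · exact ((intervalIntegrable_iff.1 hκ).aestronglyMeasurable).mul
      (hF k).aestronglyMeasurable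
  · refine .of_forall fun u hu => ?_
    rw [Real.norm_eq_abs, abs_mul]
    exact mul_le_mul_of_nonneg_left (hFM k u (hsub hu)) (abs_nonneg _)
  · exact .of_forall fun u _ => hM.mul_left _
  · simp_rw [tsum_mul_left]
    exact hκ.abs.mul_const _
  · exact .of_forall fun u hu => (hf u (hsub hu)).mul_left _

theorem abs_mittagLeffler_term_le {α l t u : ℝ} (hα : 0 < α) (hu : u ∈ Icc 0 t) (k j : ℕ) :
    |(l * u ^ α) ^ k / Real.Gamma (α * j + 1)| ≤
      (|l| * t ^ α) ^ k / Real.Gamma (α * j + 1) := by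
  rw [abs_div, abs_pow, abs_of_pos (Gamma_mul_add_one_pos hα j), abs_mul,
    abs_of_nonneg (Real.rpow_nonneg hu.1 α)]
  have := (Gamma_mul_add_one_pos hα j).le
  have := Real.rpow_le_rpow hu.1 hu.2 hα.le
  have := Real.rpow_nonneg hu.1 α
  gcongr

theorem hasSum_integral_mittagLeffler {α t : ℝ} (hα : 0 < α) (ht : 0 < t) (l : ℝ) :
    HasSum (fun k : ℕ => l ^ k * t ^ (α * k + 1) / Real.Gamma (α * k + 2))
      (∫ u in (0 : ℝ)..t, mittagLeffler α (l * u ^ α)) := by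
  have h := hasSum_integral_kernel_mul ht.le (κ := fun _ => 1)
    (F := fun k u => (l * u ^ α) ^ k / Real.Gamma (α * k + 1)) (by simp)
    (fun k => by
      have := Real.continuous_rpow_const hα.le
      fun_prop)
    (summable_mittagLeffler hα (|l| * t ^ α))
    (fun k u hu => abs_mittagLeffler_term_le hα hu k k)
    (fun u _ => hasSum_mittagLeffler hα (l * u ^ α))
  simp only [one_mul] at h
  refine h.congr_fun ?_
  intro k
  have hk : 0 ≤ α * k := by positivity
  have hcongr : ∫ u in (0 : ℝ)..t, (l * u ^ α) ^ k / Real.Gamma (α * k + 1) =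
      ∫ u in (0 : ℝ)..t, (l ^ k / Real.Gamma (α * k + 1)) * u ^ (α * k) := by
    refine intervalIntegral.integral_congr fun u hu => ?_
    rw [uIcc_of_le ht.le] at hu
    simp only [mul_pow]
    rw [Real.rpow_mul hu.1, Real.rpow_natCast]
    ring
  rw [hcongr, intervalIntegral.integral_const_mul, integral_rpow (Or.inl (by linarith)),
    Real.zero_rpow (by linarith), show α * (k : ℝ) + 2 = (α * k + 1) + 1 by ring,
    Real.Gamma_add_one (by linarith : α * (k : ℝ) + 1 ≠ 0)]
  have := Gamma_mul_add_one_pos hα k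
  field_simp
  ring

theorem rlIntegral_of_pos {β : ℝ} (hβ : 0 < β) (f : ℝ → ℝ) (t : ℝ) :
    rlIntegral β f t =
      1 / Real.Gamma β * ∫ u in (0 : ℝ)..t, (t - u) ^ (β - 1) * f u := by
  rw [rlIntegral, if_neg hβ.ne']

@[simp] theorem rlIntegral_zero_left (f : ℝ → ℝ) (t : ℝ) : rlIntegral 0 f t = f t := by
  simp [rlIntegral]

/-- Each term is a beta integral. The result is `l` times the series of
`hasSum_integral_mittagLeffler`, and this coincidence is the relaxation equation. -/
theorem hasSum_rlIntegral_mittagLeffler {α t : ℝ} (hα : 0 < α) (hα1 : α ≤ 1) (ht : 0 < t)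
    (l : ℝ) :
    HasSum (fun k : ℕ => l ^ (k + 1) * t ^ (α * k + 1) / Real.Gamma (α * k + 2))
      (rlIntegral (1 - α) (fun u => mittagLeffler α (l * u ^ α) - 1) t) := by
  rcases hα1.eq_or_lt with rfl | hα1
  · rw [sub_self, rlIntegral_zero_left]
    refine (hasSum_mittagLeffler_sub_one hα (l * t ^ (1 : ℝ))).congr_fun fun k => ?_
    rw [Real.rpow_one, mul_pow, one_mul, one_mul, ← Real.rpow_natCast t (k + 1)]
    push_cast
    ring_nf
  · have hβ : 0 < 1 - α := by linarith
    rw [rlIntegral_of_pos hβ]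
    have h := hasSum_integral_kernel_mul ht.le (κ := fun u => (t - u) ^ (1 - α - 1))
      (F := fun k u => (l * u ^ α) ^ (k + 1) / Real.Gamma (α * (k + 1 : ℕ) + 1))
      (intervalIntegrable_rpow_sub (by linarith))
      (fun k => by
        have := Real.continuous_rpow_const hα.le
        fun_prop)
      ((summable_nat_add_iff 1).2 (summable_mittagLeffler hα (|l| * t ^ α)))
      (fun k u hu => abs_mittagLeffler_term_le hα hu (k + 1) (k + 1))
      (fun u _ => hasSum_mittagLeffler_sub_one hα (l * u ^ α))
    refine (h.mul_left (1 / Real.Gamma (1 - α))).congr_fun fun k => ?_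
    have hs : 0 < α * (k + 1 : ℕ) + 1 := by positivity
    have hcongr : ∫ u in (0 : ℝ)..t, (t - u) ^ (1 - α - 1) *
          ((l * u ^ α) ^ (k + 1) / Real.Gamma (α * (k + 1 : ℕ) + 1)) =
        ∫ u in (0 : ℝ)..t, (l ^ (k + 1) / Real.Gamma (α * (k + 1 : ℕ) + 1)) *
          (u ^ ((α * (k + 1 : ℕ) + 1) - 1) * (t - u) ^ (1 - α - 1)) := by
      refine intervalIntegral.integral_congr fun u hu => ?_
      rw [uIcc_of_le ht.le] at hu
      simp only [mul_pow]
      rw [add_sub_cancel_right (α * ((k + 1 : ℕ) : ℝ)) 1, Real.rpow_mul hu.1, Real.rpow_natCast]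
      ring
    rw [hcongr, intervalIntegral.integral_const_mul, integral_rpow_mul_rpow_sub hs hβ ht]
    have h1 : α * ((k + 1 : ℕ) : ℝ) + 1 + (1 - α) = α * k + 2 := by
      push_cast
      ring
    rw [h1, show α * (k : ℝ) + 2 - 1 = α * k + 1 by ring]
    have := (Real.Gamma_pos_of_pos hs).ne'
    have := (Real.Gamma_pos_of_pos hβ).ne'
    field_simp

/-- The function `t ↦ E_α(l t^α)` solves `D^α x = l x`, in integrated form. -/
theorem rlIntegral_mittagLeffler {α t : ℝ} (hα : 0 < α) (hα1 : α ≤ 1) (ht : 0 ≤ t) (l : ℝ) :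
    rlIntegral (1 - α) (fun u => mittagLeffler α (l * u ^ α) - 1) t =
      l * ∫ u in (0 : ℝ)..t, mittagLeffler α (l * u ^ α) := by
  rcases ht.eq_or_lt with rfl | ht
  · simp [rlIntegral, Real.zero_rpow hα.ne']
  · refine (hasSum_rlIntegral_mittagLeffler hα hα1 ht l).unique ?_
    refine ((hasSum_integral_mittagLeffler hα ht l).mul_left l).congr_fun fun k => ?_
    ring

/-! ### Abel's inversion. -/

/-- The two beta parameters add up to `1`, so the power of `s - x` disappears; independence of the
endpoints is what makes the inversion work. -/
theorem intervalIntegral_abel_kernel {α x s : ℝ} (hα : 0 < α) (hα1 : α < 1) (hxs : x < s) :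
    ∫ h in x..s, (h - x) ^ (α - 1) * (s - h) ^ (-α) = Real.Gamma α * Real.Gamma (1 - α) := by
  have h := integral_rpow_mul_rpow_sub hα (by linarith : 0 < 1 - α) (sub_pos.2 hxs)
  have h2 := intervalIntegral.integral_comp_sub_right (a := x) (b := s)
    (fun u => u ^ (α - 1) * (s - x - u) ^ (1 - α - 1)) x
  simp only [sub_self, sub_sub_sub_cancel_right] at h2
  rw [h, show α + (1 - α) - 1 = 0 by ring, Real.rpow_zero, add_sub_cancel, Real.Gamma_one,
    show 1 - α - 1 = -α by ring] at h2
  rw [h2]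
  ring

theorem Gamma_mul_Gamma_one_sub_pos {α : ℝ} (hα : 0 < α) (hα1 : α < 1) :
    0 < Real.Gamma α * Real.Gamma (1 - α) :=
  mul_pos (Real.Gamma_pos_of_pos hα) (Real.Gamma_pos_of_pos (by linarith))

theorem integrableOn_abel_kernel {α x s : ℝ} (hα : 0 < α) (hα1 : α < 1) (hxs : x < s) :
    IntegrableOn (fun h => (h - x) ^ (α - 1) * (s - h) ^ (-α)) (Ioo x s) := by
  rw [← intervalIntegrable_iff_integrableOn_Ioo_of_le hxs.le]
  -- A non-integrable function has integral `0` by convention, so a nonzero value proves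
  -- integrability.
  refine intervalIntegral.intervalIntegrable_of_integral_ne_zero ?_
  rw [intervalIntegral_abel_kernel hα hα1 hxs]
  exact (Gamma_mul_Gamma_one_sub_pos hα hα1).ne'

theorem Ioc_inter_Iio_of_mem {x d s : ℝ} (hs : s ∈ Ioc x d) : Ioc x d ∩ Iio s = Ioo x s := by
  ext h
  simp only [mem_inter_iff, mem_Ioc, mem_Iio, mem_Ioo]
  exact ⟨fun h => ⟨h.1.1, h.2⟩, fun h => ⟨⟨h.1, h.2.le.trans hs.2⟩, h.2⟩⟩

theorem Ioc_inter_Ioi_of_mem {x d h : ℝ} (hh : h ∈ Ioc x d) : Ioc x d ∩ Ioi h = Ioc h d := by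
  ext s
  simp only [mem_inter_iff, mem_Ioc, mem_Ioi]
  exact ⟨fun h => ⟨h.2, h.1.2⟩, fun h => ⟨⟨hh.1.trans h.1, h.2⟩, h.1⟩⟩

/-- Abel's inversion: integrating a right-sided fractional integral of order `1 - α` against the
kernel of order `α` gives a multiple of the primitive. -/
theorem abel_inversion {α x d : ℝ} (hα : 0 < α) (hα1 : α < 1) (hxd : x ≤ d) {γ : ℝ → ℝ}
    (hγ : Continuous γ) :
    IntervalIntegrable
      (fun h => (h - x) ^ (α - 1) * ∫ s in h..d, (s - h) ^ (-α) * γ s) volume x d ∧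
    ∫ h in x..d, (h - x) ^ (α - 1) * ∫ s in h..d, (s - h) ^ (-α) * γ s =
      Real.Gamma α * Real.Gamma (1 - α) * ∫ s in x..d, γ s := by
  set B := Real.Gamma α * Real.Gamma (1 - α)
  set μ : Measure ℝ := volume.restrict (Ioc x d) with hμ
  -- Extending by zero off the triangle `h < s` lets Fubini run on the square; the two indicator
  -- forms below give its slices.
  set K : ℝ → ℝ → ℝ := fun h s =>
    if h < s then (h - x) ^ (α - 1) * (s - h) ^ (-α) * γ s else 0 with hK
  have hKi : ∀ h s, K h s =
      (Iio s).indicator (fun h => (h - x) ^ (α - 1) * (s - h) ^ (-α) * γ s) h := by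
    intro h s
    simp [hK, indicator_apply]
  have hKj : ∀ h s, K h s =
      (h - x) ^ (α - 1) * (Ioi h).indicator (fun s => (s - h) ^ (-α) * γ s) s := by
    intro h s
    by_cases hs : h < s <;> simp [hK, hs, mul_assoc]
  have hmeas : Measurable (Function.uncurry K) := by
    refine Measurable.ite (measurableSet_lt measurable_fst measurable_snd) ?_ measurable_const
    have := hγ.measurable
    fun_prop
  have hint : ∀ s ∈ Ioc x d, Integrable (fun h => K h s) μ := by
    intro s hs
    simp_rw [hKi]
    rw [integrable_indicator_iff measurableSet_Iio, IntegrableOn, hμ,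
      Measure.restrict_restrict measurableSet_Iio, inter_comm, Ioc_inter_Iio_of_mem hs]
    exact (integrableOn_abel_kernel hα hα1 hs.1).mul_const _
  have hval : ∀ s ∈ Ioc x d, ∀ c : ℝ, ∫ h, (Iio s).indicator
      (fun h => (h - x) ^ (α - 1) * (s - h) ^ (-α) * c) h ∂μ = B * c := by
    intro s hs c
    rw [MeasureTheory.integral_indicator measurableSet_Iio, hμ,
      Measure.restrict_restrict measurableSet_Iio, inter_comm, Ioc_inter_Iio_of_mem hs,
      ← integral_Ioc_eq_integral_Ioo, ← intervalIntegral.integral_of_le hs.1.le,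
      intervalIntegral.integral_mul_const, intervalIntegral_abel_kernel hα hα1 hs.1]
  have hnorm : ∀ s ∈ Ioc x d, ∫ h, ‖K h s‖ ∂μ = B * |γ s| := by
    intro s hs
    rw [← hval s hs]
    refine setIntegral_congr_fun measurableSet_Ioc fun h hh => ?_
    simp only [hKi, indicator_apply, Real.norm_eq_abs]
    split_ifs with hlt
    · have h1 : 0 ≤ (h - x) ^ (α - 1) := Real.rpow_nonneg (by linarith [hh.1]) _
      have h2 : 0 ≤ (s - h) ^ (-α) := Real.rpow_nonneg (by linarith [mem_Iio.1 hlt]) _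
      rw [abs_mul, abs_of_nonneg (mul_nonneg h1 h2)]
    · simp
  have hprod : Integrable (Function.uncurry K) (μ.prod μ) := by
    rw [integrable_prod_iff' hmeas.aestronglyMeasurable]
    constructor
    · filter_upwards [ae_restrict_mem measurableSet_Ioc] with s hs
      exact hint s hs
    · have : IntegrableOn (fun s => B * |γ s|) (Ioc x d) :=
        ((continuous_const.mul hγ.abs).integrableOn_Icc (a := x) (b := d)).mono_set
          Ioc_subset_Icc_self
      refine this.congr_fun_ae ?_
      filter_upwards [ae_restrict_mem measurableSet_Ioc] with s hs
      exact (hnorm s hs).symm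
  have hinner : ∀ h ∈ Ioc x d, ∫ s, K h s ∂μ =
      (h - x) ^ (α - 1) * ∫ s in h..d, (s - h) ^ (-α) * γ s := by
    intro h hh
    simp_rw [hKj]
    rw [MeasureTheory.integral_const_mul, MeasureTheory.integral_indicator measurableSet_Ioi, hμ,
      Measure.restrict_restrict measurableSet_Ioi, inter_comm, Ioc_inter_Ioi_of_mem hh,
      intervalIntegral.integral_of_le hh.2]
  constructor
  · rw [intervalIntegrable_iff_integrableOn_Ioc_of_le hxd]
    refine hprod.integral_prod_left.congr ?_
    filter_upwards [ae_restrict_mem measurableSet_Ioc] with h hh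
    exact hinner h hh
  · rw [intervalIntegral.integral_of_le hxd, intervalIntegral.integral_of_le hxd,
      ← MeasureTheory.integral_const_mul]
    rw [← setIntegral_congr_fun measurableSet_Ioc hinner, integral_integral_swap hprod]
    refine setIntegral_congr_fun measurableSet_Ioc fun s hs => ?_
    simp_rw [hKi]
    exact hval s hs (γ s)

/-! ### The extremum principle for fractional integrals. -/

/-- In terms of `y = x / h` this is `(1 - y)^(α-1) ≥ 1 + (1-α) y`, from Bernoulli for the exponent
`1 - α` and `(1 + z)(1 - z) ≤ 1`. It makes the gain from linear decay proportional to `x`. -/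
theorem mul_rpow_le_mul_rpow_sub_sub {α x h : ℝ} (hα : 0 < α) (hα1 : α < 1) (hx : 0 < x)
    (hxh : x < h) :
    (1 - α) * x * h ^ (α - 1) ≤ h * ((h - x) ^ (α - 1) - h ^ (α - 1)) := by
  have hh : 0 < h := hx.trans hxh
  set y := x / h with hy
  have hy0 : 0 < y := by positivity
  have hy1 : y < 1 := (div_lt_one hh).2 hxh
  have hxy : x = h * y := by
    rw [hy]
    field_simp
  have hb := rpow_one_add_le_one_add_mul_self (s := -y) (by linarith) (p := 1 - α)
    (by linarith) (by linarith)
  have hpos : 0 < (1 + -y) ^ (1 - α) := Real.rpow_pos_of_pos (by linarith) _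
  have hinv : 1 + (1 - α) * y ≤ (1 - y) ^ (α - 1) := by
    have h1 : (1 - y) ^ (α - 1) = ((1 + -y) ^ (1 - α))⁻¹ := by
      rw [← Real.rpow_neg (by linarith), neg_sub, ← sub_eq_add_neg]
    rw [h1, ← one_div, le_div_iff₀ hpos]
    calc (1 + (1 - α) * y) * (1 + -y) ^ (1 - α)
        ≤ (1 + (1 - α) * y) * (1 + (1 - α) * -y) := by
          have : 0 ≤ (1 - α) * y := mul_nonneg (by linarith) hy0.le
          gcongr
      _ ≤ 1 := by nlinarith [sq_nonneg ((1 - α) * y)]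
  have hfac : (h - x) ^ (α - 1) = h ^ (α - 1) * (1 - y) ^ (α - 1) := by
    rw [← Real.mul_rpow hh.le (by linarith), hxy]
    ring_nf
  rw [hfac, hxy]
  have hpow : 0 < h ^ (α - 1) := Real.rpow_pos_of_pos hh _
  have : 0 ≤ h * h ^ (α - 1) * ((1 - y) ^ (α - 1) - (1 + (1 - α) * y)) := by
    have := sub_nonneg.2 hinv
    positivity
  linarith

section RightSided

variable {α d : ℝ} {γ : ℝ → ℝ}

theorem intervalIntegrable_right_kernel (hα1 : α < 1) (hγ : Continuous γ) (h p r : ℝ) :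
    IntervalIntegrable (fun s => (s - h) ^ (-α) * γ s) volume p r := by
  have h1 : IntervalIntegrable (fun s : ℝ => (s - h) ^ (-α)) volume p r := by
    have := (intervalIntegrable_rpow' (a := p - h) (b := r - h)
      (by linarith : -1 < -α)).comp_sub_right h
    simpa using this
  exact h1.mul_continuousOn hγ.continuousOn

theorem right_integral_nonneg {h : ℝ} (hγ0 : ∀ s ∈ Icc 0 d, 0 ≤ γ s) (h0 : 0 ≤ h) (hd : h ≤ d) :
    0 ≤ ∫ s in h..d, (s - h) ^ (-α) * γ s := by
  refine intervalIntegral.integral_nonneg hd fun s hs => ?_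
  exact mul_nonneg (Real.rpow_nonneg (by linarith [hs.1]) _) (hγ0 s ⟨h0.trans hs.1, hs.2⟩)

/-- Discarding `[0, h]` costs at most `η ∫ s^(-α)`; on `[h, d]` moving the singularity to `h` only
enlarges the kernel. -/
theorem right_integral_sub_le {h η : ℝ} (hα : 0 < α) (hα1 : α < 1) (hγ : Continuous γ)
    (hγ0 : ∀ s ∈ Icc 0 d, 0 ≤ γ s) (h0 : 0 < h) (hd : h ≤ d) (hη : ∀ s ∈ Icc 0 h, γ s ≤ η) :
    (∫ s in (0 : ℝ)..d, (s - 0) ^ (-α) * γ s) - η * h ^ (1 - α) / (1 - α) ≤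
      ∫ s in h..d, (s - h) ^ (-α) * γ s := by
  have hsplit := intervalIntegral.integral_add_adjacent_intervals
    (intervalIntegrable_right_kernel hα1 hγ 0 0 h) (intervalIntegrable_right_kernel hα1 hγ 0 h d)
  have h1 : ∫ s in (0 : ℝ)..h, (s - 0) ^ (-α) * γ s ≤ η * h ^ (1 - α) / (1 - α) := by
    have hle : ∫ s in (0 : ℝ)..h, (s - 0) ^ (-α) * γ s ≤ ∫ s in (0 : ℝ)..h, s ^ (-α) * η := by
      refine intervalIntegral.integral_mono_on h0.le
        (intervalIntegrable_right_kernel hα1 hγ 0 0 h)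
        ((intervalIntegrable_rpow' (by linarith)).mul_const _) fun s hs => ?_
      rw [sub_zero]
      exact mul_le_mul_of_nonneg_left (hη s hs) (Real.rpow_nonneg hs.1 _)
    rw [intervalIntegral.integral_mul_const, integral_rpow (Or.inl (by linarith)),
      Real.zero_rpow (by linarith), sub_zero, show -α + 1 = 1 - α by ring] at hle
    calc _ ≤ _ := hle
      _ = _ := by ring
  have h2 : ∫ s in h..d, (s - 0) ^ (-α) * γ s ≤ ∫ s in h..d, (s - h) ^ (-α) * γ s := by
    refine intervalIntegral.integral_mono_on_of_le_Ioo hd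
      (intervalIntegrable_right_kernel hα1 hγ 0 h d)
      (intervalIntegrable_right_kernel hα1 hγ h h d) fun s hs => ?_
    refine mul_le_mul_of_nonneg_right ?_ (hγ0 s ⟨by linarith [hs.1], hs.2.le⟩)
    exact Real.rpow_le_rpow_of_nonpos (by linarith [hs.1]) (by linarith) (by linarith)
  linarith

/-- Quantitative form of the extremum principle: a linear lower bound on the decay of the
right-sided fractional integral of `γ ≥ 0` forces `γ` not to be small near `0`. -/
theorem le_of_linear_decay {c x η : ℝ} (hα : 0 < α) (hα1 : α < 1) (hx : 0 < x) (hxd : x < d)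
    (hγ : Continuous γ) (hγ0 : ∀ s ∈ Icc 0 d, 0 ≤ γ s) (hc : 0 < c)
    (hη : ∀ s ∈ Icc 0 x, γ s ≤ η)
    (hdec : ∀ h ∈ Ioo 0 d, c * h ≤
      (∫ s in (0 : ℝ)..d, (s - 0) ^ (-α) * γ s) - ∫ s in h..d, (s - h) ^ (-α) * γ s) :
    c * (1 - α) * ((d ^ α - x ^ α) / α) ≤
      (Real.Gamma α * Real.Gamma (1 - α) + 1 / (1 - α)) * η := by
  have hd : 0 < d := hx.trans hxd
  obtain ⟨hI0, hA0⟩ := abel_inversion hα hα1 hd.le hγ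
  obtain ⟨hIx, hAx⟩ := abel_inversion hα hα1 hxd.le hγ
  have hB := Gamma_mul_Gamma_one_sub_pos hα hα1
  set B := Real.Gamma α * Real.Gamma (1 - α)
  have hΦ0 := right_integral_nonneg (α := α) hγ0 le_rfl hd.le
  have hΦlow : ∀ h, 0 < h → h ≤ x → _ := fun h h0 hhx =>
    right_integral_sub_le hα hα1 hγ hγ0 h0 (hhx.trans hxd.le)
      (fun s hs => hη s ⟨hs.1, hs.2.trans hhx⟩)
  set Φ : ℝ → ℝ := fun h => ∫ s in h..d, (s - h) ^ (-α) * γ s with hΦ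
  change 0 ≤ Φ 0 at hΦ0
  change ∀ h, 0 < h → h ≤ x → Φ 0 - η * h ^ (1 - α) / (1 - α) ≤ Φ h at hΦlow
  change ∀ h ∈ Ioo 0 d, c * h ≤ Φ 0 - Φ h at hdec
  change IntervalIntegrable (fun h => (h - 0) ^ (α - 1) * Φ h) volume 0 d at hI0
  change IntervalIntegrable (fun h => (h - x) ^ (α - 1) * Φ h) volume x d at hIx
  change ∫ h in (0 : ℝ)..d, (h - 0) ^ (α - 1) * Φ h = B * ∫ s in (0 : ℝ)..d, γ s at hA0
  change ∫ h in x..d, (h - x) ^ (α - 1) * Φ h = B * ∫ s in x..d, γ s at hAx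
  clear_value Φ
  simp only [sub_zero] at hI0 hA0
  have hI0x : IntervalIntegrable (fun h => h ^ (α - 1) * Φ h) volume 0 x :=
    hI0.mono_set (by
      rw [uIcc_of_le hx.le, uIcc_of_le hd.le]
      exact Icc_subset_Icc_right hxd.le)
  have hIxd : IntervalIntegrable (fun h => h ^ (α - 1) * Φ h) volume x d :=
    hI0.mono_set (by
      rw [uIcc_of_le hxd.le, uIcc_of_le hd.le]
      exact Icc_subset_Icc_left hx.le)
  have hpow : ∀ p r : ℝ, IntervalIntegrable (fun h : ℝ => h ^ (α - 1)) volume p r := fun p r =>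
    intervalIntegrable_rpow' (by linarith)
  have hpowx : IntervalIntegrable (fun h : ℝ => (h - x) ^ (α - 1)) volume x d := by
    have := (intervalIntegrable_rpow' (a := x - x) (b := d - x)
      (by linarith : -1 < α - 1)).comp_sub_right x
    simpa using this
  have hpowval : ∀ p r : ℝ, ∫ h in p..r, h ^ (α - 1) = (r ^ α - p ^ α) / α := fun p r => by
    rw [integral_rpow (Or.inl (by linarith)), sub_add_cancel]
  have hpowxval : ∫ h in x..d, (h - x) ^ (α - 1) = (d - x) ^ α / α := by
    rw [intervalIntegral.integral_comp_sub_right (fun u => u ^ (α - 1)) x, hpowval, sub_self,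
      Real.zero_rpow hα.ne', sub_zero]
  have hnear : Φ 0 * (x ^ α / α) - η / (1 - α) * x ≤ ∫ h in (0 : ℝ)..x, h ^ (α - 1) * Φ h := by
    have hle : ∫ h in (0 : ℝ)..x, (Φ 0 * h ^ (α - 1) - η / (1 - α)) ≤
        ∫ h in (0 : ℝ)..x, h ^ (α - 1) * Φ h := by
      refine intervalIntegral.integral_mono_on_of_le_Ioo hx.le
        (((hpow 0 x).const_mul _).sub (by simp)) hI0x fun h hh => ?_
      have h1 := mul_le_mul_of_nonneg_left (hΦlow h hh.1 hh.2.le)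
        (Real.rpow_nonneg hh.1.le (α - 1))
      have h2 : h ^ (α - 1) * h ^ (1 - α) = 1 := by
        rw [← Real.rpow_add hh.1]
        simp
      calc Φ 0 * h ^ (α - 1) - η / (1 - α)
          = Φ 0 * h ^ (α - 1) - η * (h ^ (α - 1) * h ^ (1 - α)) / (1 - α) := by
            rw [h2, mul_one]
        _ = h ^ (α - 1) * (Φ 0 - η * h ^ (1 - α) / (1 - α)) := by ring
        _ ≤ _ := h1
    rw [intervalIntegral.integral_sub ((hpow 0 x).const_mul _) (by simp),
      intervalIntegral.integral_const_mul, hpowval, Real.zero_rpow hα.ne', sub_zero,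
      intervalIntegral.integral_const, sub_zero, smul_eq_mul] at hle
    linarith
  -- The kernel difference `(h-x)^(α-1) - h^(α-1)` is nonnegative and enters with a minus sign, so
  -- the upper bound `Φ h ≤ Φ 0 - c h` can be inserted; the `c h` part is bounded below by the
  -- Bernoulli estimate.
  have hfar : Φ 0 * ((d ^ α - x ^ α) / α - (d - x) ^ α / α) +
      c * (1 - α) * x * ((d ^ α - x ^ α) / α) ≤
      (∫ h in x..d, h ^ (α - 1) * Φ h) - ∫ h in x..d, (h - x) ^ (α - 1) * Φ h := by
    rw [← intervalIntegral.integral_sub hIxd hIx, ← hpowval, ← hpowxval,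
      ← intervalIntegral.integral_sub (hpow x d) hpowx, ← intervalIntegral.integral_const_mul,
      ← intervalIntegral.integral_const_mul,
      ← intervalIntegral.integral_add (((hpow x d).sub hpowx).const_mul _)
        ((hpow x d).const_mul _)]
    refine intervalIntegral.integral_mono_on_of_le_Ioo hxd.le
      ((((hpow x d).sub hpowx).const_mul _).add ((hpow x d).const_mul _)) (hIxd.sub hIx)
      fun h hh => ?_
    have h0 : 0 < h := hx.trans hh.1
    have h1 := mul_rpow_le_mul_rpow_sub_sub hα hα1 hx hh.1
    have h2 := hdec h ⟨h0, hh.2⟩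
    have h3 : 0 ≤ (h - x) ^ (α - 1) - h ^ (α - 1) :=
      sub_nonneg.2 (Real.rpow_le_rpow_of_nonpos (by linarith [hh.1]) (by linarith) (by linarith))
    have h4 := mul_le_mul_of_nonneg_left h2 h3
    have h5 := mul_le_mul_of_nonneg_left h1 hc.le
    linarith
  have hsplit := intervalIntegral.integral_add_adjacent_intervals hI0x hIxd
  have hγsplit := intervalIntegral.integral_add_adjacent_intervals
    (hγ.intervalIntegrable (μ := volume) 0 x) (hγ.intervalIntegrable (μ := volume) x d)
  have hγx : ∫ s in (0 : ℝ)..x, γ s ≤ η * x := by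
    calc ∫ s in (0 : ℝ)..x, γ s ≤ ∫ _ in (0 : ℝ)..x, η :=
          intervalIntegral.integral_mono_on hx.le (hγ.intervalIntegrable _ _) (by simp) hη
      _ = η * x := by
          simp [mul_comm]
  have hmono : 0 ≤ Φ 0 * ((d ^ α - (d - x) ^ α) / α) := by
    have := Real.rpow_le_rpow (by linarith : 0 ≤ d - x) (by linarith : d - x ≤ d) hα.le
    have := sub_nonneg.2 this
    positivity
  have hfin : c * (1 - α) * x * ((d ^ α - x ^ α) / α) ≤ B * (η * x) + η / (1 - α) * x := by
    have := mul_le_mul_of_nonneg_left hγx hB.le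
    -- Subtracting Abel's inversion at `x` from that at `0` isolates `γ` on `[0, x]`. The `Φ 0`
    -- terms of the near and far bounds then combine to the nonnegative quantity in `hmono`.
    have e : B * ∫ s in (0 : ℝ)..x, γ s =
        (∫ h in (0 : ℝ)..x, h ^ (α - 1) * Φ h) + (∫ h in x..d, h ^ (α - 1) * Φ h) -
          ∫ h in x..d, (h - x) ^ (α - 1) * Φ h := by
      rw [hsplit, hA0, hAx, ← hγsplit]
      ring
    have e2 : Φ 0 * ((d ^ α - (d - x) ^ α) / α) = Φ 0 * (x ^ α / α) +
      Φ 0 * ((d ^ α - x ^ α) / α - (d - x) ^ α / α) := by ring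
    linarith
  refine le_of_mul_le_mul_right ?_ hx
  calc _ = c * (1 - α) * x * ((d ^ α - x ^ α) / α) := by ring
    _ ≤ _ := hfin
    _ = _ := by ring

theorem not_linear_decay {c : ℝ} (hα : 0 < α) (hα1 : α < 1) (hd : 0 < d)
    (hγ : Continuous γ) (hγ0 : ∀ s ∈ Icc 0 d, 0 ≤ γ s) (hγz : γ 0 = 0) (hc : 0 < c) :
    ¬ ∀ h ∈ Ioo 0 d, c * h ≤
      (∫ s in (0 : ℝ)..d, (s - 0) ^ (-α) * γ s) - ∫ s in h..d, (s - h) ^ (-α) * γ s := by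
  intro hdec
  set K := Real.Gamma α * Real.Gamma (1 - α) + 1 / (1 - α) with hKdef
  have hα' : 0 < 1 - α := by linarith
  have hK : 0 < K := add_pos (Gamma_mul_Gamma_one_sub_pos hα hα1) (by positivity)
  have hdα : 0 < d ^ α := Real.rpow_pos_of_pos hd α
  -- The factor `4` makes the upper bound `K η` a quarter of the limiting value as `x → 0`, while `x
  -- ^ α < d ^ α / 2` keeps the lower bound above half of it.
  set η := c * (1 - α) * (d ^ α / α) / (4 * K) with hη
  have hηpos : 0 < η := by positivity
  have h1 : ∀ᶠ s in 𝓝 (0 : ℝ), γ s < η :=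
    hγ.continuousAt.eventually_lt continuousAt_const (by rwa [hγz])
  have h2 : ∀ᶠ s in 𝓝 (0 : ℝ), s ^ α < d ^ α / 2 :=
    (Real.continuous_rpow_const hα.le).continuousAt.eventually_lt continuousAt_const
      (by rw [Real.zero_rpow hα.ne']; positivity)
  obtain ⟨ε, hε, hball⟩ := Metric.eventually_nhds_iff.1 (h1.and h2)
  set x := min (ε / 2) (d / 2) with hx
  have hx0 : 0 < x := by positivity
  have hxε : x < ε := (min_le_left _ _).trans_lt (by linarith)
  have hxd : x < d := (min_le_right _ _).trans_lt (by linarith)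
  have hsmall : ∀ s ∈ Icc 0 x, dist s 0 < ε := fun s hs => by
    rw [Real.dist_eq, sub_zero, abs_of_nonneg hs.1]
    exact hs.2.trans_lt hxε
  have h3 := le_of_linear_decay hα hα1 hx0 hxd hγ hγ0 hc
    (fun s hs => (hball (hsmall s hs)).1.le) hdec
  have h4 := (hball (hsmall x ⟨hx0.le, le_rfl⟩)).2
  rw [← hKdef] at h3
  have h5 : K * η = c * (1 - α) * (d ^ α / α) / 4 := by
    rw [hη]
    field_simp
  have h6 : c * (1 - α) * ((d ^ α / 2) / α) < c * (1 - α) * ((d ^ α - x ^ α) / α) := by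
    have : d ^ α / 2 < d ^ α - x ^ α := by linarith
    gcongr
  have h7 : 0 < c * (1 - α) * (d ^ α / α) := by positivity
  have h8 : c * (1 - α) * ((d ^ α / 2) / α) = c * (1 - α) * (d ^ α / α) / 2 := by ring
  linarith

end RightSided

/-- Extremum principle for fractional integrals: if `g ≥ 0` is continuous on `[0, T]` and vanishes
at `T`, then `I^{1-α} g` does not increase linearly up to `T`. -/
theorem not_linear_growth_rlIntegral {α T c δ : ℝ} {g : ℝ → ℝ} (hα : 0 < α) (hα1 : α ≤ 1)
    (hT : 0 < T) (hg : ContinuousOn g (Icc 0 T)) (hg0 : ∀ t ∈ Icc 0 T, 0 ≤ g t) (hgT : g T = 0)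
    (hc : 0 < c) (hδ : 0 < δ) :
    ¬ ∀ h ∈ Ioo 0 δ, c * h ≤ rlIntegral (1 - α) g T - rlIntegral (1 - α) g (T - h) := by
  intro hgrow
  set d := min δ T with hd
  have hd0 : 0 < d := lt_min hδ hT
  have hdT : d ≤ T := min_le_right _ _
  have hdδ : d ≤ δ := min_le_left _ _
  rcases hα1.eq_or_lt with rfl | hα1
  · have h1 := hgrow (d / 2) ⟨by linarith, by linarith⟩
    rw [sub_self, rlIntegral_zero_left, rlIntegral_zero_left, hgT] at h1
    have h2 := hg0 (T - d / 2) ⟨by linarith, by linarith⟩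
    have : 0 < c * (d / 2) := by positivity
    linarith
  have hβ : 0 < 1 - α := by linarith
  have hG := Real.Gamma_pos_of_pos hβ
  -- Time reversal about `T`, clamped so that `γ` is continuous on the whole line.
  set γ : ℝ → ℝ := fun s => g (max 0 (min T (T - s))) with hγdef
  have hγ : Continuous γ := by
    refine hg.comp_continuous (by fun_prop) fun s => ?_
    exact ⟨le_max_left _ _, max_le hT.le (min_le_left _ _)⟩
  have hγeq : ∀ s ∈ Icc 0 T, γ s = g (T - s) := fun s hs => by
    change g (max 0 (min T (T - s))) = _
    rw [min_eq_right (by linarith [hs.1]), max_eq_right (by linarith [hs.2])]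
  have hγ0 : ∀ s ∈ Icc 0 d, 0 ≤ γ s := fun s hs =>
    hg0 _ ⟨le_max_left _ _, max_le hT.le (min_le_left _ _)⟩
  have hγz : γ 0 = 0 := by
    rw [hγeq 0 ⟨le_rfl, hT.le⟩, sub_zero, hgT]
  have hrefl : ∀ h ∈ Ico 0 d, ∫ s in h..d, (s - h) ^ (-α) * γ s =
      ∫ u in (T - d)..(T - h), (T - h - u) ^ (1 - α - 1) * g u := by
    intro h hh
    rw [← intervalIntegral.integral_comp_sub_left
      (fun u => (T - h - u) ^ (1 - α - 1) * g u) T]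
    refine intervalIntegral.integral_congr fun s hs => ?_
    rw [uIcc_of_le hh.2.le] at hs
    rw [hγeq s ⟨hh.1.trans hs.1, hs.2.trans hdT⟩]
    congr 2 <;> ring
  have hgint : ∀ t p r, 0 ≤ p → p ≤ r → r ≤ T →
      IntervalIntegrable (fun u => (t - u) ^ (1 - α - 1) * g u) volume p r :=
    fun t p r hp hpr hr => intervalIntegrable_rpow_sub_mul (by linarith) (hg.mono (by
      rw [uIcc_of_le hpr]
      exact Icc_subset_Icc hp hr))
  have hsplit : ∀ h ∈ Ico 0 d, rlIntegral (1 - α) g (T - h) = 1 / Real.Gamma (1 - α) *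
      ((∫ u in (0 : ℝ)..(T - d), (T - h - u) ^ (1 - α - 1) * g u) +
        ∫ s in h..d, (s - h) ^ (-α) * γ s) := by
    intro h hh
    rw [rlIntegral_of_pos hβ, hrefl h hh, intervalIntegral.integral_add_adjacent_intervals
      (hgint _ _ _ le_rfl (by linarith) (by linarith))
      (hgint _ _ _ (by linarith) (by linarith [hh.2]) (by linarith [hh.1]))]
  refine not_linear_decay hα hα1 hd0 hγ hγ0 hγz (mul_pos hG hc) fun h hh => ?_
  have h1 := hgrow h ⟨hh.1, hh.2.trans_le hdδ⟩
  have h0 := hsplit 0 ⟨le_rfl, hd0⟩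
  rw [sub_zero] at h0
  rw [h0, hsplit h ⟨hh.1.le, hh.2⟩] at h1
  -- The kernel is decreasing in elapsed time, so the contribution of the distant past shrinks from
  -- `T - h` to `T`; all growth must come from the last window of length `d`.
  have hfar : ∫ u in (0 : ℝ)..(T - d), (T - u) ^ (1 - α - 1) * g u ≤
      ∫ u in (0 : ℝ)..(T - d), (T - h - u) ^ (1 - α - 1) * g u := by
    refine intervalIntegral.integral_mono_on (by linarith)
      (hgint _ _ _ le_rfl (by linarith) (by linarith))
      (hgint _ _ _ le_rfl (by linarith) (by linarith)) fun u hu => ?_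
    refine mul_le_mul_of_nonneg_right ?_ (hg0 u ⟨hu.1, by linarith [hu.2]⟩)
    exact Real.rpow_le_rpow_of_nonpos (by linarith [hu.2, hh.2]) (by linarith [hh.1])
      (by linarith)
  rw [← mul_sub, one_div, inv_mul_eq_div, le_div_iff₀ hG] at h1
  linarith

/-! ### Linearity, monotonicity and shifts of the fractional integral. -/

section Algebra

variable {β t : ℝ} {f g : ℝ → ℝ}

theorem intervalIntegrable_rlIntegral (hβ : 0 < β) (ht : 0 ≤ t) (hf : ContinuousOn f (Icc 0 t)) :
    IntervalIntegrable (fun u => (t - u) ^ (β - 1) * f u) volume 0 t :=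
  intervalIntegrable_rpow_sub_mul (by linarith) (by rwa [uIcc_of_le ht])

theorem rlIntegral_congr (ht : 0 ≤ t) (h : EqOn f g (Icc 0 t)) :
    rlIntegral β f t = rlIntegral β g t := by
  unfold rlIntegral
  split_ifs
  · exact h ⟨ht, le_rfl⟩
  · congr 1
    refine intervalIntegral.integral_congr fun u hu => ?_
    rw [uIcc_of_le ht] at hu
    rw [h hu]

theorem rlIntegral_add (hβ : 0 ≤ β) (ht : 0 ≤ t) (hf : ContinuousOn f (Icc 0 t))
    (hg : ContinuousOn g (Icc 0 t)) :
    rlIntegral β (fun u => f u + g u) t = rlIntegral β f t + rlIntegral β g t := by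
  rcases hβ.eq_or_lt with rfl | hβ
  · simp
  · simp only [rlIntegral_of_pos hβ, mul_add]
    rw [intervalIntegral.integral_add (intervalIntegrable_rlIntegral hβ ht hf)
      (intervalIntegrable_rlIntegral hβ ht hg), mul_add]

theorem rlIntegral_const_mul (c : ℝ) :
    rlIntegral β (fun u => c * f u) t = c * rlIntegral β f t := by
  unfold rlIntegral
  split_ifs
  · rfl
  · simp only [mul_left_comm _ c]
    rw [intervalIntegral.integral_const_mul]
    ring

theorem rlIntegral_sub (hβ : 0 ≤ β) (ht : 0 ≤ t) (hf : ContinuousOn f (Icc 0 t))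
    (hg : ContinuousOn g (Icc 0 t)) :
    rlIntegral β (fun u => f u - g u) t = rlIntegral β f t - rlIntegral β g t := by
  have h := rlIntegral_add hβ ht hf (g := fun u => -1 * g u) (continuousOn_const.mul hg)
  rw [rlIntegral_const_mul] at h
  simp only [neg_one_mul, ← sub_eq_add_neg] at h
  exact h

/-- The fractional integral of a nonnegative nondecreasing function is nondecreasing. -/
theorem rlIntegral_mono_of_monotone {s : ℝ} (hβ : 0 ≤ β) (hs : 0 ≤ s) (hst : s ≤ t)
    (hf : ContinuousOn f (Icc 0 t)) (hmono : MonotoneOn f (Icc 0 t)) (h0 : 0 ≤ f 0) :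
    rlIntegral β f s ≤ rlIntegral β f t := by
  have ht : 0 ≤ t := hs.trans hst
  have hnn : ∀ u ∈ Icc 0 t, 0 ≤ f u := fun u hu =>
    h0.trans (hmono ⟨le_rfl, ht⟩ hu hu.1)
  rcases hβ.eq_or_lt with rfl | hβ
  · simpa using hmono ⟨hs, hst⟩ ⟨ht, le_rfl⟩ hst
  -- Reversing the variable makes the kernel independent of `r`, so increasing `r` raises the
  -- integrand and extends the domain.
  have hrefl : ∀ r, ∫ u in (0 : ℝ)..r, (r - u) ^ (β - 1) * f u =
      ∫ v in (0 : ℝ)..r, v ^ (β - 1) * f (r - v) := fun r => by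
    have := intervalIntegral.integral_comp_sub_left (a := 0) (b := r)
      (fun u => (r - u) ^ (β - 1) * f u) r
    simpa using this.symm
  have hint : ∀ r p q : ℝ, 0 ≤ p → p ≤ q → q ≤ r → r ≤ t →
      IntervalIntegrable (fun v => v ^ (β - 1) * f (r - v)) volume p q := by
    intro r p q hp hpq hqr hrt
    refine (intervalIntegrable_rpow' (by linarith)).mul_continuousOn ?_
    refine hf.comp (by fun_prop) fun v hv => ?_
    rw [uIcc_of_le hpq] at hv
    exact ⟨by linarith [hv.2], by linarith [hv.1]⟩
  rw [rlIntegral_of_pos hβ, rlIntegral_of_pos hβ, hrefl, hrefl]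
  have hG := Real.Gamma_pos_of_pos hβ
  refine mul_le_mul_of_nonneg_left ?_ (by positivity)
  rw [← intervalIntegral.integral_add_adjacent_intervals (hint t 0 s le_rfl hs hst le_rfl)
    (hint t s t hs hst le_rfl le_rfl)]
  have h1 : ∫ v in (0 : ℝ)..s, v ^ (β - 1) * f (s - v) ≤
      ∫ v in (0 : ℝ)..s, v ^ (β - 1) * f (t - v) := by
    refine intervalIntegral.integral_mono_on hs (hint s 0 s le_rfl hs le_rfl hst)
      (hint t 0 s le_rfl hs hst le_rfl) fun v hv => ?_
    refine mul_le_mul_of_nonneg_left ?_ (Real.rpow_nonneg hv.1 _)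
    exact hmono ⟨by linarith [hv.2], by linarith [hv.1]⟩ ⟨by linarith [hv.2], by linarith [hv.1]⟩
      (by linarith)
  have h2 : 0 ≤ ∫ v in s..t, v ^ (β - 1) * f (t - v) := by
    refine intervalIntegral.integral_nonneg hst fun v hv => ?_
    exact mul_nonneg (Real.rpow_nonneg (hs.trans hv.1) _)
      (hnn _ ⟨by linarith [hv.2], by linarith [hv.1]⟩)
  linarith

/-- Used to pass from `x - x 0` in the Caputo derivative to `x` itself: a nonnegative constant only
adds growth. -/
theorem rlIntegral_const_mono {s c : ℝ} (hβ : 0 ≤ β) (hs : 0 ≤ s) (hst : s ≤ t) (hc : 0 ≤ c) :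
    rlIntegral β (fun _ => c) s ≤ rlIntegral β (fun _ => c) t :=
  rlIntegral_mono_of_monotone hβ hs hst continuousOn_const monotoneOn_const hc

/-- A function vanishing on `[0, s]` may be shifted inside a fractional integral. -/
theorem rlIntegral_shift {s : ℝ} (hβ : 0 ≤ β) (hs : 0 ≤ s) (ht : 0 ≤ t)
    (hf : ContinuousOn f (Icc 0 (t + s))) (hzero : ∀ u ∈ Icc 0 s, f u = 0) :
    rlIntegral β f (t + s) = rlIntegral β (fun u => f (u + s)) t := by
  rcases hβ.eq_or_lt with rfl | hβ
  · simp
  have hint : ∀ p q : ℝ, 0 ≤ p → p ≤ q → q ≤ t + s →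
      IntervalIntegrable (fun u => (t + s - u) ^ (β - 1) * f u) volume p q := by
    intro p q hp hpq hq
    refine intervalIntegrable_rpow_sub_mul (by linarith) (hf.mono ?_)
    rw [uIcc_of_le hpq]
    exact Icc_subset_Icc hp hq
  rw [rlIntegral_of_pos hβ, rlIntegral_of_pos hβ,
    ← intervalIntegral.integral_add_adjacent_intervals (hint 0 s le_rfl hs (by linarith))
      (hint s (t + s) hs (by linarith) le_rfl)]
  have h1 : ∫ u in (0 : ℝ)..s, (t + s - u) ^ (β - 1) * f u = 0 := by
    refine intervalIntegral.integral_zero_ae (.of_forall fun u hu => ?_)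
    rw [uIoc_of_le hs] at hu
    rw [hzero u ⟨hu.1.le, hu.2⟩, mul_zero]
  have h2 := intervalIntegral.integral_comp_add_right (a := 0) (b := t)
    (fun u => (t + s - u) ^ (β - 1) * f u) s
  simp only [add_sub_add_right_eq_sub, zero_add] at h2
  rw [h1, zero_add, h2]

end Algebra

/-! ### First zeros and the comparison principle. -/

/-- A continuous function positive at `0` and negative at some later time has a first zero. -/
theorem exists_first_zero {g : ℝ → ℝ} {t : ℝ} (hg : ContinuousOn g (Icc 0 t)) (ht : 0 ≤ t)
    (h0 : 0 < g 0) (hneg : g t < 0) :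
    ∃ T, 0 < T ∧ T ≤ t ∧ g T = 0 ∧ ∀ s ∈ Icc 0 T, 0 ≤ g s := by
  set S : Set ℝ := Icc 0 t ∩ g ⁻¹' Iic 0 with hS
  have hclosed : IsClosed S := hg.preimage_isClosed_of_isClosed isClosed_Icc isClosed_Iic
  have hne : S.Nonempty := ⟨t, ⟨ht, le_rfl⟩, hneg.le⟩
  have hbdd : BddBelow S := ⟨0, fun x hx => hx.1.1⟩
  have hmem : sInf S ∈ S := hclosed.csInf_mem hne hbdd
  set T := sInf S with hT
  have hpos : ∀ s ∈ Ico 0 T, 0 < g s := fun s hs => by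
    by_contra hcon
    exact absurd (csInf_le hbdd (show s ∈ S from
      ⟨⟨hs.1, hs.2.le.trans hmem.1.2⟩, not_lt.1 hcon⟩)) (not_le.2 hs.2)
  have hT0 : 0 < T := lt_of_le_of_ne hmem.1.1 fun h => by
    have : g T ≤ 0 := hmem.2
    rw [← h] at this
    linarith
  have hgT : g T = 0 := by
    refine le_antisymm hmem.2 ?_
    have hcont : ContinuousWithinAt g (Ico 0 T) T :=
      (hg T hmem.1).mono fun s hs => ⟨hs.1, hs.2.le.trans hmem.1.2⟩
    have hcl : T ∈ closure (Ico 0 T) := by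
      rw [closure_Ico hT0.ne]
      exact ⟨hT0.le, le_rfl⟩
    have := hcont.mem_closure hcl (t := Ici 0) fun s hs => (hpos s hs).le
    rwa [isClosed_Ici.closure_eq] at this
  refine ⟨T, hT0, hmem.1.2, hgT, fun s hs => ?_⟩
  rcases hs.2.eq_or_lt with rfl | hlt
  · exact hgT.ge
  · exact (hpos s ⟨hs.1, hlt⟩).le

/-- Supersolutions of the linear fractional equation `D^α z = -l z` with nonnegative initial value
are nonnegative. -/
theorem nonneg_of_supersolution {α l : ℝ} (hα : 0 < α) (hα1 : α ≤ 1) (hl : 0 < l) {z : ℝ → ℝ}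
    (hz : Continuous z) (hz0 : 0 ≤ z 0)
    (hsup : ∀ s t, 0 ≤ s → s ≤ t → -l * ∫ u in s..t, z u ≤
      rlIntegral (1 - α) (fun u => z u - z 0) t - rlIntegral (1 - α) (fun u => z u - z 0) s)
    {t : ℝ} (ht : 0 ≤ t) : 0 ≤ z t := by
  by_contra! hneg
  set ε := -z t / 2 with hε
  have hε0 : 0 < ε := by linarith
  obtain ⟨T, hT, -, hzT, hpos⟩ := exists_first_zero (g := fun s => z s + ε)
    (by fun_prop) ht (by linarith) (by linarith)
  -- Since `z T = -ε`, the term `-l ∫ z` contributes at least `l (ε / 2) h` over `[T - h, T]`: the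
  -- linear growth that is excluded.
  have hnear : ∀ᶠ s in 𝓝 T, z s < -ε / 2 :=
    hz.continuousAt.eventually_lt continuousAt_const (by linarith)
  obtain ⟨δ, hδ, hball⟩ := Metric.eventually_nhds_iff.1 hnear
  refine not_linear_growth_rlIntegral hα hα1 hT (g := fun s => z s + ε) (by fun_prop) hpos hzT
    (c := l * (ε / 2)) (by positivity) (δ := min δ T) (lt_min hδ hT) fun h hh => ?_
  have hhδ : h < δ := hh.2.trans_le (min_le_left _ _)
  have hhT : h < T := hh.2.trans_le (min_le_right _ _)
  have hsplit : ∀ r, 0 ≤ r → rlIntegral (1 - α) (fun s => z s + ε) r =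
      rlIntegral (1 - α) (fun u => z u - z 0) r + rlIntegral (1 - α) (fun _ => z 0 + ε) r := by
    intro r hr
    rw [← rlIntegral_add (by linarith) hr (by fun_prop) (by fun_prop)]
    exact rlIntegral_congr hr fun u _ => by ring
  rw [hsplit T hT.le, hsplit (T - h) (by linarith)]
  have h1 := rlIntegral_const_mono (β := 1 - α) (t := T) (s := T - h) (c := z 0 + ε)
    (by linarith) (by linarith) (by linarith [hh.1]) (by linarith)
  have h2 := hsup (T - h) T (by linarith) (by linarith [hh.1])
  have h3 : ∫ u in (T - h)..T, z u ≤ ∫ _ in (T - h)..T, -ε / 2 := by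
    refine intervalIntegral.integral_mono_on (by linarith [hh.1]) (hz.intervalIntegrable _ _)
      (by simp) fun u hu => (hball ?_).le
    rw [Real.dist_eq, abs_lt]
    exact ⟨by linarith [hu.1], by linarith [hu.2]⟩
  rw [intervalIntegral.integral_const, smul_eq_mul] at h3
  have h4 := mul_le_mul_of_nonneg_left h3 hl.le
  linarith

/-! ### Positivity, monotonicity and supermultiplicativity of the relaxation function. -/

section Relaxation

variable {α l s t : ℝ}

theorem mittagLeffler_mul_zero_rpow (hα : 0 < α) (l : ℝ) :
    mittagLeffler α (l * (0 : ℝ) ^ α) = 1 := by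
  rw [Real.zero_rpow hα.ne', mul_zero, mittagLeffler_zero]

theorem rlIntegral_mittagLeffler_sub (hα : 0 < α) (hα1 : α ≤ 1) (hs : 0 ≤ s) (ht : 0 ≤ t)
    (l : ℝ) :
    rlIntegral (1 - α) (fun u => mittagLeffler α (-l * u ^ α) - 1) t -
      rlIntegral (1 - α) (fun u => mittagLeffler α (-l * u ^ α) - 1) s =
      -l * ∫ u in s..t, mittagLeffler α (-l * u ^ α) := by
  have hi := fun a b => (continuous_mittagLeffler_mul_rpow hα l).intervalIntegrable
    (μ := volume) a b
  rw [rlIntegral_mittagLeffler hα hα1 ht, rlIntegral_mittagLeffler hα hα1 hs, ← mul_sub,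
    intervalIntegral.integral_interval_sub_left (hi _ _) (hi _ _)]

theorem mittagLeffler_neg_mul_rpow_nonneg (hα : 0 < α) (hα1 : α ≤ 1) (hl : 0 ≤ l) (ht : 0 ≤ t) :
    0 ≤ mittagLeffler α (-l * t ^ α) := by
  rcases hl.eq_or_lt with rfl | hl
  · simp
  refine nonneg_of_supersolution hα hα1 hl (z := fun t => mittagLeffler α (-l * t ^ α))
    (continuous_mittagLeffler_mul_rpow hα l) ?_ (fun s t hs hst => ?_) ht
  · simp only [mittagLeffler_mul_zero_rpow hα]
    exact zero_le_one
  · simp only [mittagLeffler_mul_zero_rpow hα]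
    exact (rlIntegral_mittagLeffler_sub hα hα1 hs (hs.trans hst) l).ge

/-- The difference `z = e - e'` satisfies `D^α z = -l' z + (l' - l) e` with `e ≥ 0`, so it is a
supersolution for the rate `l'` with initial value `0`. -/
theorem mittagLeffler_neg_mul_rpow_anti {l' : ℝ} (hα : 0 < α) (hα1 : α ≤ 1) (hl : 0 ≤ l)
    (hll : l ≤ l') (ht : 0 ≤ t) :
    mittagLeffler α (-l' * t ^ α) ≤ mittagLeffler α (-l * t ^ α) := by
  rcases hll.eq_or_lt with rfl | hlt
  · exact le_rfl
  have h1 := fun s t hs ht => rlIntegral_mittagLeffler_sub (s := s) (t := t) hα hα1 hs ht l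
  have h2 := fun s t hs ht => rlIntegral_mittagLeffler_sub (s := s) (t := t) hα hα1 hs ht l'
  have hnn := fun t ht => mittagLeffler_neg_mul_rpow_nonneg (t := t) hα hα1 hl ht
  have hc := continuous_mittagLeffler_mul_rpow hα l
  have hc' := continuous_mittagLeffler_mul_rpow hα l'
  have h0 : mittagLeffler α (-l * (0 : ℝ) ^ α) = 1 := mittagLeffler_mul_zero_rpow hα _
  have h0' : mittagLeffler α (-l' * (0 : ℝ) ^ α) = 1 := mittagLeffler_mul_zero_rpow hα _
  generalize he : (fun t : ℝ => mittagLeffler α (-l * t ^ α)) = e at hc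
  generalize he' : (fun t : ℝ => mittagLeffler α (-l' * t ^ α)) = e' at hc'
  simp only [fun t : ℝ => (congrFun he t : mittagLeffler α (-l * t ^ α) = e t),
    fun t : ℝ => (congrFun he' t : mittagLeffler α (-l' * t ^ α) = e' t)] at h0 h0' h1 h2 hnn ⊢
  have key := nonneg_of_supersolution hα hα1 (hl.trans_lt hlt) (z := fun t => e t - e' t)
    (by fun_prop) (by simp [h0, h0']) (fun s t hs hst => ?_) ht
  · exact sub_nonneg.1 key
  have hsplit : ∀ r, 0 ≤ r → rlIntegral (1 - α) (fun u => e u - e' u - (e 0 - e' 0)) r =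
      rlIntegral (1 - α) (fun u => e u - 1) r - rlIntegral (1 - α) (fun u => e' u - 1) r := by
    intro r hr
    rw [← rlIntegral_sub (by linarith) hr (by fun_prop) (by fun_prop)]
    refine rlIntegral_congr hr fun u _ => ?_
    simp only [h0, h0']
    ring
  simp only [hsplit t (hs.trans hst), hsplit s hs]
  have h3 : 0 ≤ ∫ u in s..t, e u :=
    intervalIntegral.integral_nonneg hst fun u hu => hnn u (hs.trans hu.1)
  rw [intervalIntegral.integral_sub (hc.intervalIntegrable _ _) (hc'.intervalIntegrable _ _)]
  have h4 := mul_nonneg (sub_nonneg.2 hll) h3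
  linarith [h1 s t hs (hs.trans hst), h2 s t hs (hs.trans hst)]

theorem mittagLeffler_monotone (hα : 0 < α) (hα1 : α ≤ 1) : Monotone (mittagLeffler α) := by
  have hneg : MonotoneOn (mittagLeffler α) (Iic 0) := by
    intro x hx y hy hxy
    have := mittagLeffler_neg_mul_rpow_anti (l := -y) (l' := -x) hα hα1
      (neg_nonneg.2 hy) (neg_le_neg hxy) zero_le_one
    simpa using this
  exact hneg.Iic_union_Ici (mittagLeffler_monotoneOn hα)

theorem mittagLeffler_nonneg (hα : 0 < α) (hα1 : α ≤ 1) (x : ℝ) : 0 ≤ mittagLeffler α x := by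
  rcases le_total 0 x with hx | hx
  · exact zero_le_one.trans (one_le_mittagLeffler hα hx)
  · have := mittagLeffler_neg_mul_rpow_nonneg (l := -x) hα hα1 (neg_nonneg.2 hx) zero_le_one
    simpa using this

theorem mittagLeffler_mul_rpow_antitone (hα : 0 < α) (hα1 : α ≤ 1) (hl : 0 ≤ l) (hs : 0 ≤ s)
    (hst : s ≤ t) : mittagLeffler α (-l * t ^ α) ≤ mittagLeffler α (-l * s ^ α) := by
  refine mittagLeffler_monotone hα hα1 ?_
  have := mul_le_mul_of_nonneg_left (Real.rpow_le_rpow hs hst hα.le) hl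
  linarith

/-- The delayed relaxation function is a supersolution: the memory of the initial segment only
helps, because the relaxation function is nonincreasing. -/
theorem rlIntegral_shift_mittagLeffler_le {r : ℝ} (hα : 0 < α) (hα1 : α ≤ 1) (hl : 0 ≤ l)
    (hr : 0 ≤ r) (hs : 0 ≤ s) (hst : s ≤ t) :
    -l * ∫ u in s..t, mittagLeffler α (-l * (u + r) ^ α) ≤
      rlIntegral (1 - α)
        (fun u => mittagLeffler α (-l * (u + r) ^ α) - mittagLeffler α (-l * r ^ α)) t -
      rlIntegral (1 - α)
        (fun u => mittagLeffler α (-l * (u + r) ^ α) - mittagLeffler α (-l * r ^ α)) s := by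
  have hc := continuous_mittagLeffler_mul_rpow hα l
  set e : ℝ → ℝ := fun t => mittagLeffler α (-l * t ^ α) with he
  have hcm : Continuous fun u => e (min u r) := hc.comp (by fun_prop)
  -- The function `e u - e (min u r)` vanishes on `[0, r]`, so it may be shifted by `r`. It splits
  -- into `e - 1`, governed by the relaxation equation, and `1 - e (min u r)`, which is
  -- nondecreasing from `0`.
  have hsplit : ∀ p, 0 ≤ p → rlIntegral (1 - α) (fun u => e (u + r) - e r) p =
      rlIntegral (1 - α) (fun u => e u - 1) (p + r) +
        rlIntegral (1 - α) (fun u => 1 - e (min u r)) (p + r) := by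
    intro p hp
    rw [← rlIntegral_add (by linarith) (by linarith) (by fun_prop) (by fun_prop),
      rlIntegral_shift (by linarith) hr hp
        (by fun_prop)
        (fun u hu => by rw [min_eq_left hu.2]; ring)]
    refine rlIntegral_congr hp fun u hu => ?_
    rw [min_eq_right (by linarith [hu.1])]
    ring
  have hmono : rlIntegral (1 - α) (fun u => 1 - e (min u r)) (s + r) ≤
      rlIntegral (1 - α) (fun u => 1 - e (min u r)) (t + r) := by
    refine rlIntegral_mono_of_monotone (by linarith) (by linarith) (by linarith)
      (by fun_prop) (fun u hu v hv huv => ?_) ?_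
    · have := mittagLeffler_mul_rpow_antitone hα hα1 hl (le_min hu.1 hr)
        (min_le_min_right r huv)
      exact sub_le_sub_left this 1
    · rw [min_eq_left hr, he]
      simp only [mittagLeffler_mul_zero_rpow hα]
      norm_num
  have h1 := rlIntegral_mittagLeffler_sub hα hα1 (add_nonneg hs hr)
    (add_nonneg (hs.trans hst) hr) l
  change _ ≤ rlIntegral (1 - α) (fun u => e (u + r) - e r) t -
    rlIntegral (1 - α) (fun u => e (u + r) - e r) s
  have h2 := intervalIntegral.integral_comp_add_right (a := s) (b := t) e r
  change -l * ∫ u in s..t, e (u + r) ≤ _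
  rw [hsplit t (hs.trans hst), hsplit s hs, h2]
  linarith

/-- The relaxation function `t ↦ E_α(-l t^α)` is supermultiplicative. -/
theorem mittagLeffler_mul_le_add (hα : 0 < α) (hα1 : α ≤ 1) (hl : 0 ≤ l) (hs : 0 ≤ s)
    (ht : 0 ≤ t) :
    mittagLeffler α (-l * s ^ α) * mittagLeffler α (-l * t ^ α) ≤
      mittagLeffler α (-l * (t + s) ^ α) := by
  rcases hl.eq_or_lt with rfl | hl
  · simp
  have h1 := fun s t hs ht => rlIntegral_mittagLeffler_sub (s := s) (t := t) hα hα1 hs ht l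
  have h2 := fun p q hp hpq =>
    rlIntegral_shift_mittagLeffler_le (s := p) (t := q) hα hα1 hl.le hs hp hpq
  have hc := continuous_mittagLeffler_mul_rpow hα l
  have h0 : mittagLeffler α (-l * (0 : ℝ) ^ α) = 1 := mittagLeffler_mul_zero_rpow hα _
  generalize he : (fun t : ℝ => mittagLeffler α (-l * t ^ α)) = e at hc
  simp only [fun t : ℝ => (congrFun he t : mittagLeffler α (-l * t ^ α) = e t)] at h0 h1 h2 ⊢
  have hcs : Continuous fun t => e (t + s) := by fun_prop
  -- The shifted profile is a supersolution and `e s * e t` an exact solution, with the same initial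
  -- value `e s`.
  have key := nonneg_of_supersolution hα hα1 hl (z := fun t => e (t + s) - e s * e t)
    (by fun_prop) (by simp [h0]) (fun p q hp hpq => ?_) ht
  · exact sub_nonneg.1 key
  have hsplit : ∀ r, 0 ≤ r → rlIntegral (1 - α)
      (fun u => e (u + s) - e s * e u - (e (0 + s) - e s * e 0)) r =
      rlIntegral (1 - α) (fun u => e (u + s) - e s) r -
        e s * rlIntegral (1 - α) (fun u => e u - 1) r := by
    intro r hr
    rw [← rlIntegral_const_mul, ← rlIntegral_sub (by linarith) hr (by fun_prop) (by fun_prop)]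
    refine rlIntegral_congr hr fun u _ => ?_
    simp only [h0, zero_add]
    ring
  simp only [hsplit q (hp.trans hpq), hsplit p hp]
  rw [intervalIntegral.integral_sub (hcs.intervalIntegrable _ _)
    ((hc.intervalIntegrable _ _).const_mul _), intervalIntegral.integral_const_mul]
  have h3 : e s * (rlIntegral (1 - α) (fun u => e u - 1) q -
      rlIntegral (1 - α) (fun u => e u - 1) p) = e s * (-l * ∫ u in p..q, e u) := by
    rw [h1 p q hp (hp.trans hpq)]
  linarith [h2 p q hp hpq]

/-- Supermultiplicativity carries a zero at time `1` back to all times `2^(-n)`, against continuity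
at `0`, where the value is `1`. -/
theorem mittagLeffler_pos (hα : 0 < α) (hα1 : α ≤ 1) (x : ℝ) : 0 < mittagLeffler α x := by
  rcases le_total 0 x with hx | hx
  · exact zero_lt_one.trans_le (one_le_mittagLeffler hα hx)
  refine (mittagLeffler_nonneg hα hα1 x).lt_of_ne' fun hzero => ?_
  set e : ℝ → ℝ := fun t => mittagLeffler α (-(-x) * t ^ α) with he
  have hhalf : ∀ n : ℕ, e ((1 / 2) ^ n) = 0 := by
    intro n
    induction n with
    | zero => simpa [he] using hzero
    | succ n ih =>
      have hp : (0 : ℝ) ≤ (1 / 2) ^ (n + 1) := by positivity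
      have h := mittagLeffler_mul_le_add hα hα1 (neg_nonneg.2 hx) hp hp
      rw [show (1 / 2 : ℝ) ^ (n + 1) + (1 / 2) ^ (n + 1) = (1 / 2) ^ n by ring] at h
      change e _ * e _ ≤ e _ at h
      rw [ih] at h
      exact mul_self_eq_zero.1 (le_antisymm h (mul_self_nonneg _))
  have hlim : Tendsto (fun n : ℕ => e ((1 / 2) ^ n)) atTop (𝓝 (e 0)) :=
    ((continuous_mittagLeffler_mul_rpow hα (-x)).tendsto 0).comp
      (tendsto_pow_atTop_nhds_zero_of_lt_one (by norm_num) (by norm_num))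
  simp only [hhalf] at hlim
  have h1 : e 0 = 1 := mittagLeffler_mul_zero_rpow hα _
  rw [h1] at hlim
  exact zero_ne_one (tendsto_nhds_unique tendsto_const_nhds hlim)

end Relaxation

/-! ### Roots of the characteristic function. -/

section CharacteristicRoots

variable {m : ℕ} {α : ℝ} {a : ℝ → ℝ} {b q : Fin m → ℝ → ℝ} {t : ℝ}

theorem charFun_strictMono (hα : 0 < α) (hα1 : α ≤ 1) (hb : ∀ k, 0 ≤ b k t)
    (hq : ∀ k, 0 ≤ q k t) : StrictMono (charFun α a b q t) := by
  intro l l' hll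
  refine add_lt_add_of_lt_of_le (sub_lt_sub_right hll _) (Finset.sum_le_sum fun k _ => ?_)
  refine div_le_div_of_nonneg_left (hb k) (mittagLeffler_pos hα hα1 _)
    (mittagLeffler_monotone hα hα1 ?_)
  have := mul_le_mul_of_nonneg_right hll.le (Real.rpow_nonneg (hq k) α)
  linarith

theorem continuous_charFun (hα : 0 < α) (hα1 : α ≤ 1) : Continuous (charFun α a b q t) := by
  refine (continuous_id.sub continuous_const).add (continuous_finsetSum _ fun k _ => ?_)
  refine continuous_const.div ((continuous_mittagLeffler hα).comp (by fun_prop)) fun l => ?_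
  exact (mittagLeffler_pos hα hα1 _).ne'

/-- The value at `0` is `∑ bₖ - a ≤ 0` and the value at `a t` is a sum of nonnegative terms; strict
monotonicity gives uniqueness. -/
theorem existsUnique_charFun_root (hα : 0 < α) (hα1 : α ≤ 1) (hb : ∀ k, 0 ≤ b k t)
    (hq : ∀ k, 0 ≤ q k t) (hab : ∑ k, b k t ≤ a t) : ∃! l, charFun α a b q t l = 0 := by
  have ha : 0 ≤ a t := (Finset.sum_nonneg fun k _ => hb k).trans hab
  have h0 : charFun α a b q t 0 ≤ 0 := by
    simp only [charFun, neg_zero, zero_mul, mittagLeffler_zero, div_one]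
    linarith
  have h1 : 0 ≤ charFun α a b q t (a t) := by
    simp only [charFun, sub_self, zero_add]
    exact Finset.sum_nonneg fun k _ => div_nonneg (hb k) (mittagLeffler_nonneg hα hα1 _)
  obtain ⟨l, -, hl⟩ := intermediate_value_Icc ha
    (continuous_charFun (a := a) (b := b) (q := q) hα hα1).continuousOn ⟨h0, h1⟩
  exact ⟨l, hl, fun y hy =>
    (charFun_strictMono hα hα1 hb hq).injective (hy.trans hl.symm)⟩

/-- A uniform positive lower bound for the characteristic roots. -/
theorem exists_pos_charFun_nonpos {τ a₀ p : ℝ} (hα : 0 < α) (hα1 : α ≤ 1) (ha₀ : 0 < a₀)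
    (hp : p < 1) (hb : ∀ k t, 0 ≤ t → 0 ≤ b k t) (hq : ∀ k t, 0 ≤ t → q k t ∈ Icc 0 τ)
    (ha : ∀ t, 0 ≤ t → a₀ ≤ a t) (hab : ∀ t, 0 ≤ t → ∑ k, b k t ≤ p * a t) :
    ∃ l, 0 < l ∧ ∀ t, 0 ≤ t → charFun α a b q t l ≤ 0 := by
  have hcont : Continuous fun l : ℝ => p / mittagLeffler α (-l * τ ^ α) :=
    continuous_const.div ((continuous_mittagLeffler hα).comp (by fun_prop)) fun l =>
      (mittagLeffler_pos hα hα1 _).ne'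
  have hev : ∀ᶠ l in 𝓝 (0 : ℝ), p / mittagLeffler α (-l * τ ^ α) < (1 + p) / 2 :=
    hcont.continuousAt.eventually_lt continuousAt_const (by simp; linarith)
  obtain ⟨ε, hε, hball⟩ := Metric.eventually_nhds_iff.1 hev
  have hgap : 0 < a₀ * (1 - p) / 2 := by
    have : 0 < 1 - p := by linarith
    positivity
  -- The delayed sum is at most `a (1 + p) / 2`, which leaves `a (1 - p) / 2 ≥ l` to absorb the
  -- linear term.
  set l := min (ε / 2) (a₀ * (1 - p) / 2) with hl
  have hl0 : 0 < l := lt_min (by linarith) hgap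
  have hlε : l < ε := (min_le_left _ _).trans_lt (by linarith)
  have hla : l ≤ a₀ * (1 - p) / 2 := min_le_right _ _
  refine ⟨l, hl0, fun t ht => ?_⟩
  have hE := mittagLeffler_pos hα hα1 (-l * τ ^ α)
  have hp' : p / mittagLeffler α (-l * τ ^ α) < (1 + p) / 2 := hball (by
    rw [Real.dist_eq, sub_zero, abs_of_pos hl0]
    exact hlε)
  have hsum : ∑ k, b k t / mittagLeffler α (-l * q k t ^ α) ≤
      a t * (p / mittagLeffler α (-l * τ ^ α)) := by
    calc ∑ k, b k t / mittagLeffler α (-l * q k t ^ α)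
        ≤ ∑ k, b k t / mittagLeffler α (-l * τ ^ α) := by
          refine Finset.sum_le_sum fun k _ => ?_
          exact div_le_div_of_nonneg_left (hb k t ht) hE
            (mittagLeffler_mul_rpow_antitone hα hα1 hl0.le (hq k t ht).1 (hq k t ht).2)
      _ = (∑ k, b k t) / mittagLeffler α (-l * τ ^ α) := by rw [Finset.sum_div]
      _ ≤ p * a t / mittagLeffler α (-l * τ ^ α) := by
          gcongr
          exact hab t ht
      _ = _ := by ring
  have hat := ha t ht
  have h1 := mul_le_mul_of_nonneg_left hp'.le (ha₀.le.trans hat)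
  have h2 := mul_le_mul_of_nonneg_right hat (by linarith : 0 ≤ (1 - p) / 2)
  rw [charFun]
  linarith

end CharacteristicRoots

/-! ### The Halanay inequality by first contact with a barrier. -/

theorem exists_linear_growth_of_hasDerivAt {f : ℝ → ℝ} {f' x c : ℝ} (hf : HasDerivAt f f' x)
    (hc : c < f') : ∃ δ, 0 < δ ∧ ∀ h ∈ Ioo 0 δ, c * h ≤ f x - f (x - h) := by
  have h1 := hf.tendsto_slope.eventually_const_lt hc
  rw [eventually_nhdsWithin_iff] at h1
  obtain ⟨δ, hδ, hball⟩ := Metric.eventually_nhds_iff.1 h1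
  refine ⟨δ, hδ, fun h hh => ?_⟩
  have h2 := hball (y := x - h)
    (by rw [Real.dist_eq, sub_sub_cancel_left, abs_neg, abs_of_pos hh.1]; exact hh.2)
    (by simpa using hh.1.ne')
  rw [slope_def_field, sub_sub_cancel_left, div_neg, ← neg_div, neg_sub, lt_div_iff₀ hh.1] at h2
  exact h2.le

/-- Along a relaxation profile, looking back by at most `r` costs at most the factor
`1 / E_α(-l r^α)`. -/
theorem mittagLeffler_delay_le {α l r s T : ℝ} (hα : 0 < α) (hα1 : α ≤ 1) (hl : 0 ≤ l)
    (hs : 0 ≤ s) (hsT : s ≤ T) (hr : T - r ≤ s) :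
    mittagLeffler α (-l * s ^ α) ≤
      mittagLeffler α (-l * T ^ α) / mittagLeffler α (-l * r ^ α) := by
  rw [le_div_iff₀ (mittagLeffler_pos hα hα1 _)]
  have h1 := mittagLeffler_mul_rpow_antitone (s := T - s) (t := r) hα hα1 hl (by linarith)
    (by linarith)
  have h2 := mittagLeffler_mul_le_add (s := s) (t := T - s) hα hα1 hl hs (by linarith)
  rw [sub_add_cancel] at h2
  exact (mul_le_mul_of_nonneg_left h1 (mittagLeffler_nonneg hα hα1 _)).trans h2

/-- Fractional Halanay inequality with an admissible decay rate `L`. -/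
theorem halanay_bound {m : ℕ} {α τ L M w₀ : ℝ} {w a c : ℝ → ℝ} {b q : Fin m → ℝ → ℝ}
    (hα : 0 < α) (hα1 : α ≤ 1) (hτ : 0 < τ) (hL : 0 ≤ L) (hM : 0 ≤ M) (hw₀ : 0 ≤ w₀)
    (hw : ContinuousOn w (Ici (-τ)))
    (hwD : ∀ t, 0 < t → CaputoDifferentiableAt α w t)
    (hb : ∀ k t, 0 ≤ t → 0 ≤ b k t) (hq : ∀ k t, 0 ≤ t → q k t ∈ Icc 0 τ)
    (hineq : ∀ t, 0 < t → caputoDeriv α w t ≤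
      -a t * w t + ∑ k, b k t * sSup (w '' Icc (t - q k t) t) + c t)
    (hinit : ∀ s ∈ Icc (-τ) 0, w s ≤ M)
    (hchar : ∀ t, 0 ≤ t → charFun α a b q t L ≤ 0)
    (hgap : ∀ t, 0 ≤ t → ∑ k, b k t < a t)
    (hc : ∀ t, 0 ≤ t → c t ≤ (a t - ∑ k, b k t) * w₀) {t : ℝ} (ht : 0 ≤ t) :
    w t ≤ w₀ + M * mittagLeffler α (-L * t ^ α) := by
  have hI := fun t ht => rlIntegral_mittagLeffler (t := t) hα hα1 ht (-L)
  have hdelay := fun r s T hs hsT hr =>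
    mittagLeffler_delay_le (r := r) (s := s) (T := T) hα hα1 hL hs hsT hr
  have hanti := fun s t hs hst =>
    mittagLeffler_mul_rpow_antitone (s := s) (t := t) hα hα1 hL hs hst
  have hpos := fun t : ℝ => mittagLeffler_pos hα hα1 (-L * t ^ α)
  have h0 : mittagLeffler α (-L * (0 : ℝ) ^ α) = 1 := mittagLeffler_mul_zero_rpow hα _
  have he := continuous_mittagLeffler_mul_rpow hα L
  simp only [charFun] at hchar
  generalize hedef : (fun t : ℝ => mittagLeffler α (-L * t ^ α)) = e at he
  simp only [fun t : ℝ => (congrFun hedef t : mittagLeffler α (-L * t ^ α) = e t)] at *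
  have hwc : ∀ r, ContinuousOn w (Icc 0 r) := fun r =>
    hw.mono fun s hs => mem_Ici.2 (by linarith [hs.1])
  by_contra! hlt
  set ε := (w t - (w₀ + M * e t)) / 2 with hε
  have hε0 : 0 < ε := by linarith
  have hw00 : w 0 ≤ M := hinit 0 ⟨by linarith, le_rfl⟩
  obtain ⟨T, hT, -, hgT, hg⟩ := exists_first_zero (g := fun s => w₀ + M * e s + ε - w s) (t := t)
    (by have := hwc t; fun_prop) ht (by simp only [h0]; linarith) (by linarith)
  have hwT : w T = w₀ + M * e T + ε := by linarith
  -- At times `s ≥ 0` the barrier and the delay estimate apply. A time `s ≤ 0` is in the window only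
  -- if `T ≤ q k T`; then the ratio is at least `1` and the initial bound `M` suffices.
  have hsup : ∀ k, sSup (w '' Icc (T - q k T) T) ≤ w₀ + ε + M * (e T / e (q k T)) := by
    intro k
    have hqk := hq k T hT.le
    refine csSup_le ((nonempty_Icc.2 (by linarith [hqk.1])).image w) ?_
    rintro _ ⟨s, hs, rfl⟩
    rcases le_total 0 s with hs0 | hs0
    · have h1 : 0 ≤ w₀ + M * e s + ε - w s := hg s ⟨hs0, hs.2⟩
      have h2 := mul_le_mul_of_nonneg_left (hdelay (q k T) s T hs0 hs.2 hs.1) hM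
      linarith
    · have h1 := hinit s ⟨by linarith [hs.1, hqk.2], hs0⟩
      have h2 : 1 ≤ e T / e (q k T) :=
        (one_le_div (hpos _)).2 (hanti T (q k T) hT.le (by linarith [hs.1]))
      have h3 := mul_le_mul_of_nonneg_left h2 hM
      linarith
  set D := a T - ∑ k, b k T with hD
  have hD0 : 0 < D := sub_pos.2 (hgap T hT.le)
  -- The characteristic inequality handles the `M e` part, `c ≤ D w₀` the constant part, and the
  -- shift `ε` leaves the strict surplus `D ε`.
  have hderiv : caputoDeriv α w T ≤ -L * (M * e T) - D * ε := by
    have h1 : ∑ k, b k T * sSup (w '' Icc (T - q k T) T) ≤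
        (w₀ + ε) * ∑ k, b k T + M * e T * ∑ k, b k T / e (q k T) := by
      rw [Finset.mul_sum, Finset.mul_sum, ← Finset.sum_add_distrib]
      refine Finset.sum_le_sum fun k _ => ?_
      calc b k T * sSup (w '' Icc (T - q k T) T)
          ≤ b k T * (w₀ + ε + M * (e T / e (q k T))) :=
            mul_le_mul_of_nonneg_left (hsup k) (hb k T hT.le)
        _ = _ := by ring
    have h2 := mul_le_mul_of_nonneg_left (hchar T hT.le) (mul_nonneg hM (hpos T).le)
    have h3 := hc T hT.le
    have h4 := hineq T hT
    rw [hwT] at h4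
    rw [hD] at *
    linarith
  set J : ℝ → ℝ := rlIntegral (1 - α) (fun u => w u - w 0) with hJ
  have hG : HasDerivAt (fun r => M * (-L * ∫ u in (0 : ℝ)..r, e u) - J r)
      (M * (-L * e T) - caputoDeriv α w T) T := by
    refine HasDerivAt.sub (((intervalIntegral.integral_hasDerivAt_right
      (he.intervalIntegrable _ _) (he.stronglyMeasurableAtFilter _ _)
      he.continuousAt).const_mul _).const_mul _) ?_
    exact (hwD T hT).hasDerivAt
  obtain ⟨δ, hδ, hgrow⟩ := exists_linear_growth_of_hasDerivAt hG (c := D * ε / 2) (by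
    have : 0 < D * ε := mul_pos hD0 hε0
    linarith)
  -- The constant is the initial gap, nonnegative because `w 0 ≤ M`, so its fractional integral is
  -- nondecreasing.
  have hsplit : ∀ r, 0 ≤ r → rlIntegral (1 - α) (fun s => w₀ + M * e s + ε - w s) r =
      (M * (-L * ∫ u in (0 : ℝ)..r, e u) - J r) +
        rlIntegral (1 - α) (fun _ => w₀ + M + ε - w 0) r := by
    intro r hr
    have hwr := hwc r
    rw [← hI r hr, ← rlIntegral_const_mul, hJ, ← rlIntegral_sub (by linarith) hr (by fun_prop)
      (by fun_prop), ← rlIntegral_add (by linarith) hr (by fun_prop) (by fun_prop)]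
    exact rlIntegral_congr hr fun u _ => by ring
  refine not_linear_growth_rlIntegral hα hα1 hT (g := fun s => w₀ + M * e s + ε - w s)
    (by have := hwc T; fun_prop) hg hgT (c := D * ε / 2) (by positivity) (δ := min δ T)
    (lt_min hδ hT) fun h hh => ?_
  have hhT : h < T := hh.2.trans_le (min_le_right _ _)
  have h1 := hgrow h ⟨hh.1, hh.2.trans_le (min_le_left _ _)⟩
  have h2 := rlIntegral_const_mono (β := 1 - α) (t := T) (s := T - h) (c := w₀ + M + ε - w 0)
    (by linarith) (by linarith) (by linarith [hh.1]) (by linarith)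
  rw [hsplit T hT.le, hsplit (T - h) (by linarith)]
  linarith

end FracHalanay

/-! ### The main theorem. -/

theorem corollary2p7
    (α : ℝ) (hα0 : 0 < α) (hα1 : α ≤ 1)
    (τ : ℝ) (hτ : 0 < τ) (m : ℕ)
    (w φ a c : ℝ → ℝ) (b q : Fin m → ℝ → ℝ)
    (hw : ContinuousOn w (Set.Ici (-τ)))
    (hw0 : ∀ t, -τ ≤ t → 0 ≤ w t)
    (hwD : ∀ t, 0 < t → FracHalanay.CaputoDifferentiableAt α w t)
    (hφ : ContinuousOn φ (Set.Icc (-τ) 0))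
    (hφ0 : ∀ s ∈ Set.Icc (-τ) 0, 0 ≤ φ s)
    (ha : ContinuousOn a (Set.Ici 0)) (ha0 : ∀ t, 0 ≤ t → 0 ≤ a t)
    (hb : ∀ k, ContinuousOn (b k) (Set.Ici 0)) (hb0 : ∀ k t, 0 ≤ t → 0 ≤ b k t)
    (hc : ContinuousOn c (Set.Ici 0)) (hc0 : ∀ t, 0 ≤ t → 0 ≤ c t)
    (hq : ∀ k, ContinuousOn (q k) (Set.Ici 0))
    (hqτ : ∀ k t, 0 ≤ t → q k t ∈ Set.Icc 0 τ)
    (hineq : ∀ t, 0 < t →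
      FracHalanay.caputoDeriv α w t
        ≤ -a t * w t + ∑ k, b k t * sSup (w '' Set.Icc (t - q k t) t) + c t)
    (hinit : ∀ s ∈ Set.Icc (-τ) 0, w s = φ s)
    (cstar : ℝ) (hcstar : IsLUB (c '' Set.Ici 0) cstar)
    (w₀ : ℝ)
    (hC :
      (∃ σ : ℝ, 0 < σ ∧ (∃ a₁ : ℝ, ∀ t, 0 ≤ t → a t ≤ a₁) ∧
        (∀ t, 0 ≤ t → σ ≤ a t - ∑ k, b k t) ∧ w₀ = cstar / σ) ∨
      (∃ a₀ p : ℝ, 0 < a₀ ∧ p < 1 ∧ (∀ t, 0 ≤ t → a₀ ≤ a t) ∧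
        (∀ t, 0 ≤ t → ∑ k, b k t / a t ≤ p) ∧ w₀ = cstar / ((1 - p) * a₀))) :
    (∀ t, 0 ≤ t → ∃! l : ℝ, FracHalanay.charFun α a b q t l = 0) ∧
    0 ≤ w₀ ∧
    0 < FracHalanay.lambdaStar α a b q ∧
    ∀ t, 0 ≤ t →
      w t ≤ w₀ + sSup ((fun s => |φ s|) '' Set.Icc (-τ) 0) *
        FracHalanay.mittagLeffler α (-FracHalanay.lambdaStar α a b q * t ^ α) := by
  have hccs : ∀ t, 0 ≤ t → c t ≤ cstar := fun t ht => hcstar.1 ⟨t, ht, rfl⟩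
  have hcs0 : 0 ≤ cstar := (hc0 0 le_rfl).trans (hccs 0 le_rfl)
  have hsum0 : ∀ t, 0 ≤ t → 0 ≤ ∑ k, b k t := fun t ht =>
    Finset.sum_nonneg fun k _ => hb0 k t ht
  -- Both conditions give a dominance gap `κ` with `w₀ = cstar / κ`, and proportional dominance
  obtain ⟨κ, a₀, p, hκ, ha₀, hp, hκgap, hw₀, haa₀, hbp⟩ : ∃ κ a₀ p : ℝ, 0 < κ ∧ 0 < a₀ ∧ p < 1 ∧
      (∀ t, 0 ≤ t → κ ≤ a t - ∑ k, b k t) ∧ w₀ = cstar / κ ∧ (∀ t, 0 ≤ t → a₀ ≤ a t) ∧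
      ∀ t, 0 ≤ t → ∑ k, b k t ≤ p * a t := by
    rcases hC with ⟨σ, hσ, ⟨a₁, ha₁⟩, hgap, hw₀⟩ | ⟨a₀, p, ha₀, hp, haa₀, hbp, hw₀⟩
    · have hσa : ∀ t, 0 ≤ t → σ ≤ a t := fun t ht => by linarith [hgap t ht, hsum0 t ht]
      have ha₁0 : 0 < a₁ := hσ.trans_le ((hσa 0 le_rfl).trans (ha₁ 0 le_rfl))
      -- Boundedness of `a` turns the absolute gap into a ratio: `∑ bₖ ≤ a - σ ≤ (1 - σ / a₁) a`.
      refine ⟨σ, σ, 1 - σ / a₁, hσ, hσ, by linarith [div_pos hσ ha₁0], hgap, hw₀, hσa,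
        fun t ht => ?_⟩
      have h1 : σ / a₁ * a t ≤ σ := by
        rw [div_mul_eq_mul_div, div_le_iff₀ ha₁0]
        exact mul_le_mul_of_nonneg_left (ha₁ t ht) hσ.le
      linarith [hgap t ht]
    · have hbp' : ∀ t, 0 ≤ t → ∑ k, b k t ≤ p * a t := fun t ht => by
        have h1 := hbp t ht
        rwa [← Finset.sum_div, div_le_iff₀ (ha₀.trans_le (haa₀ t ht))] at h1
      refine ⟨(1 - p) * a₀, a₀, p, mul_pos (by linarith) ha₀, ha₀, hp, fun t ht => ?_, hw₀, haa₀,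
        hbp'⟩
      have h1 := mul_le_mul_of_nonneg_left (haa₀ t ht) (by linarith : 0 ≤ 1 - p)
      linarith [hbp' t ht]
  have hw₀0 : 0 ≤ w₀ := by
    rw [hw₀]
    positivity
  have hgap : ∀ t, 0 ≤ t → ∑ k, b k t < a t := fun t ht => by linarith [hκgap t ht]
  have hroot : ∀ t, 0 ≤ t → ∃! l : ℝ, FracHalanay.charFun α a b q t l = 0 := fun t ht =>
    FracHalanay.existsUnique_charFun_root hα0 hα1 (fun k => hb0 k t ht)
      (fun k => (hqτ k t ht).1) (hgap t ht).le
  have hmono : ∀ t, 0 ≤ t → StrictMono (FracHalanay.charFun α a b q t) := fun t ht =>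
    FracHalanay.charFun_strictMono hα0 hα1 (fun k => hb0 k t ht) (fun k => (hqτ k t ht).1)
  obtain ⟨l₀, hl₀, hl₀char⟩ :=
    FracHalanay.exists_pos_charFun_nonpos hα0 hα1 ha₀ hp hb0 hqτ haa₀ hbp
  have hlower : l₀ ∈ lowerBounds
      {l : ℝ | ∃ t : ℝ, 0 ≤ t ∧ FracHalanay.charFun α a b q t l = 0} := by
    rintro l ⟨t, ht, hl⟩
    exact (hmono t ht).le_iff_le.1 ((hl₀char t ht).trans hl.ge)
  have hpos : 0 < FracHalanay.lambdaStar α a b q := by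
    obtain ⟨l, hl, -⟩ := hroot 0 le_rfl
    exact hl₀.trans_le (le_csInf ⟨l, 0, le_rfl, hl⟩ hlower)
  -- `λ*` lies below every root, and each characteristic function is increasing.
  have hchar : ∀ t, 0 ≤ t →
      FracHalanay.charFun α a b q t (FracHalanay.lambdaStar α a b q) ≤ 0 := fun t ht => by
    obtain ⟨l, hl, -⟩ := hroot t ht
    exact ((hmono t ht).monotone (csInf_le ⟨l₀, hlower⟩ ⟨t, ht, hl⟩)).trans hl.le
  have hbdd : BddAbove ((fun s => |φ s|) '' Set.Icc (-τ) 0) :=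
    (isCompact_Icc.image_of_continuousOn hφ.abs).bddAbove
  have hφM : ∀ s ∈ Set.Icc (-τ) 0, |φ s| ≤ sSup ((fun s => |φ s|) '' Set.Icc (-τ) 0) :=
    fun s hs => le_csSup hbdd ⟨s, hs, rfl⟩
  refine ⟨hroot, hw₀0, hpos, fun t ht => ?_⟩
  refine FracHalanay.halanay_bound hα0 hα1 hτ hpos.le
    ((abs_nonneg _).trans (hφM 0 ⟨by linarith, le_rfl⟩)) hw₀0 hw hwD hb0 hqτ hineq
    (fun s hs => ?_) hchar hgap (fun t ht => ?_) ht
  · rw [hinit s hs]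
    exact (le_abs_self _).trans (hφM s hs)
  · calc c t ≤ κ * w₀ := by
          rw [hw₀, mul_div_cancel₀ _ hκ.ne']
          exact hccs t ht
      _ ≤ _ := mul_le_mul_of_nonneg_right (hκgap t ht) hw₀0
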